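/- Let $D\in(0,1)$. For $k\ge1$ put $m_k:=k+1$, $a_k:=m_k^{-1/D}$ and $c_k:=2^{-k}$, and let $C^{(m,a)}\subset[0,1]$ (for an integer $m\ge2$ and $a>0$ with $ma<1$) be the generalized Cantor set obtained by keeping in $[0,1]$ the $m$ equidistant closed intervals of length $a$ separated by $m-1$ holes of length $(1-ma)/(m-1)$, repeating this in each remaining interval (scaled by $a$) ad infinitum, and taking the intersection. Let $\mathcal L_k$ be the bounded fractal string of $c_kC^{(m_k,a_k)}$, i.e. the nonincreasing sequence of lengths, with multiplicities, of the bounded connected components of its complement in $\mathbb R$, and let $\mathcal L=(\ell_j)_{j\ge1}=\bigsqcup_{k\ge1}\mathcal L_k$ be the disjoint union (as multisets, arranged in nonincreasing order). Then: (1) $\mathcal L$ is a bounded fractal string (that is, an infinite nonincreasing sequence of positive numbers with $\sum_j\ell_j<\infty$), its upper inner Minkowski dimension (defined by the Lebesgue measure of the sets $\{x\in\Omega:d(x,\partial\Omega)<t\}$, $t\to0^+$, for the geometric realization $\Omega=\bigcup_k(\sum_{j\ge k+1}\ell_j,\sum_{j\ge k}\ell_j)$) equals $D$, and the abscissa of absolute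 convergence of its geometric zeta function $\zeta_{\mathcal L}(s)=\sum_{j}\ell_j^s$ equals $D$. (2) $\mathcal L$ is maximally hyperfractal: every point $s_0$ of the critical line $\{\operatorname{Re}s=D\}$ is a nonremovable singularity of $\zeta_{\mathcal L}$, i.e. $\zeta_{\mathcal L}|_{\{\operatorname{Re}s>D\}}$ has no holomorphic continuation to any open disk centered at $s_0$. (3) The bounded set $A_{\mathcal L}:=\{\sum_{j\ge k}\ell_j:k\ge1\}\subset\mathbb R$ has upper Minkowski (box) dimension $D$. For every $\delta>0$, its distance zeta function $\zeta_{A_{\mathcal L}}(s)=\int_{\{x\in\mathbb R:\,d(x,A_{\mathcal L})<\delta\}}d(x,A_{\mathcal L})^{s-1}\,dx$ has abscissa of absolute convergence $D$, and every point of the line $\{\operatorname{Re}s=D\}$ is a nonremovable singularity of $\zeta_{A_{\mathcal L}}$ (in the same sense); that is, $A_{\mathcal L}$ is maximally hyperfractal. -/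

import Mathlib

noncomputable section

namespace FractalZeta

open Filter Topology MeasureTheory Set

/-! ### Fractal strings and generalized Cantor sets -/

/-- A (nontrivial) bounded fractal string: an infinite nonincreasing sequence of positive
lengths with finite total length. The index starts at `0`. -/
structure IsBoundedFractalString (ℓ : ℕ → ℝ) : Prop where
  pos : ∀ j, 0 < ℓ j
  antitone : Antitone ℓ
  summable : Summable ℓ

/-- `ℓ` is the disjoint union `⨆ₖ Lₖ` of the strings `L k`, as multisets: the terms of `ℓ` are
the terms of all the `L k`, counted with multiplicity. -/
def IsDisjointUnion (ℓ : ℕ → ℝ) (L : ℕ → ℕ → ℝ) : Prop :=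
  ∃ e : ℕ ≃ ℕ × ℕ, ∀ j, ℓ j = L (e j).1 (e j).2

/-- The length `(1 - m a) / (m - 1)` of the holes of the first step of the construction of the
generalized Cantor set. -/
def holeLength (m : ℕ) (a : ℝ) : ℝ := (1 - m * a) / (m - 1)

/-- The steps of the construction of the generalized Cantor set: step `0` is `[0,1]`; step `1`
consists of `m` equidistant closed intervals of length `a`, the first one starting at `0` and the
last one ending at `1`; the next step is the union of the copies of the present one, scaled by
the factor `a`, in these `m` intervals. -/
def cantorStep (m : ℕ) (a : ℝ) : ℕ → Set ℝ
  | 0 => Icc 0 1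
  | n + 1 => ⋃ i : Fin m,
      (fun x : ℝ => a * x + ((i : ℕ) : ℝ) * (a + holeLength m a)) '' cantorStep m a n

/-- The generalized Cantor set `C^{(m,a)}` (for an integer `m ≥ 2` and `a > 0` with `m a < 1`). -/
def generalizedCantorSet (m : ℕ) (a : ℝ) : Set ℝ := ⋂ n, cantorStep m a n

/-- The scaled generalized Cantor set `c C^{(m,a)}`. -/
def scaledCantorSet (c : ℝ) (m : ℕ) (a : ℝ) : Set ℝ :=
  (fun x : ℝ => c * x) '' generalizedCantorSet m a

/-- The gaps of a compact set `K ⊆ ℝ`, that is, the bounded connected components `(u, v)` of its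
complement, given by their end points. -/
def gaps (K : Set ℝ) : Set (ℝ × ℝ) :=
  {p | p.1 ∈ K ∧ p.2 ∈ K ∧ p.1 < p.2 ∧ Disjoint (Ioo p.1 p.2) K}

/-- `ℓ` is the bounded fractal string of the compact set `K ⊆ ℝ`: it lists in nonincreasing order
the lengths of the gaps of `K`, counted with multiplicity. -/
def IsFractalStringOf (ℓ : ℕ → ℝ) (K : Set ℝ) : Prop :=
  IsBoundedFractalString ℓ ∧ ∃ e : ℕ ≃ gaps K, ∀ j, ℓ j = (e j).1.2 - (e j).1.1

/-- The points `a_k = ∑_{j ≥ k} ℓ_j`. -/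
def stringPoint (ℓ : ℕ → ℝ) (k : ℕ) : ℝ := ∑' j, ℓ (k + j)

/-- The set `A_ℓ = {a_k}` associated with the string `ℓ`. -/
def stringSet (ℓ : ℕ → ℝ) : Set ℝ := range (stringPoint ℓ)

/-- The bounded open set `⋃_k (a_{k+1}, a_k)`, a geometric realization of the string `ℓ`: its
connected components are intervals of lengths `ℓ_k`. -/
def stringDomain (ℓ : ℕ → ℝ) : Set ℝ :=
  ⋃ k, Ioo (stringPoint ℓ (k + 1)) (stringPoint ℓ k)

/-! ### Upper Minkowski dimensions in `ℝ` -/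

/-- The upper `r`-dimensional content `limsup_{t → 0+} V(t) / t^{1-r}` of a tube function `V`. -/
def upperContent (V : ℝ → ENNReal) (r : ℝ) : ENNReal :=
  limsup (fun t : ℝ => V t / ENNReal.ofReal (t ^ (1 - r))) (𝓝[>] 0)

/-- The critical exponent `inf {r > 0 : upper r-dimensional content is 0}`. -/
def upperExponent (V : ℝ → ENNReal) : ℝ := sInf {r : ℝ | 0 < r ∧ upperContent V r = 0}

/-- The upper Minkowski (box) dimension of a bounded set `A ⊆ ℝ`, defined through the Lebesgue
measure of its `t`-neighborhoods `A_t = {x : d(x, A) < t}`. -/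
def upperMinkowskiDim (A : Set ℝ) : ℝ :=
  upperExponent fun t => volume (Metric.thickening t A)

/-- The upper (inner) Minkowski dimension of a bounded fractal string, defined through the
inner `t`-neighborhoods `{x ∈ Ω : d(x, ∂Ω) < t}` of a geometric realization `Ω`. -/
def stringUpperMinkowskiDim (ℓ : ℕ → ℝ) : ℝ :=
  upperExponent fun t =>
    volume {x ∈ stringDomain ℓ | Metric.infDist x (frontier (stringDomain ℓ)) < t}

/-! ### Zeta functions and maximal hyperfractality -/

/-- Let `f` be holomorphic on the half-plane `{Re s > c}` and let `Re s₀ = c`. Then `s₀` is a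
nonremovable singularity of `f` if `f` cannot be continued from this half-plane to a
holomorphic function in some open disk around `s₀`. -/
def IsNonremovableSingularity (f : ℂ → ℂ) (c : ℝ) (s₀ : ℂ) : Prop :=
  ¬ ∃ ρ > 0, ∃ g : ℂ → ℂ, DifferentiableOn ℂ g (Metric.ball s₀ ρ) ∧
    EqOn f g (Metric.ball s₀ ρ ∩ {s | c < s.re})

/-- The geometric zeta function `∑_j ℓ_j^s` of a fractal string. -/
def geometricZeta (ℓ : ℕ → ℝ) (s : ℂ) : ℂ := ∑' j, (ℓ j : ℂ) ^ s

/-- The abscissa of (absolute) convergence of the geometric zeta function. -/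
def geometricAbscissa (ℓ : ℕ → ℝ) : ℝ := sInf {α : ℝ | Summable fun j => ℓ j ^ α}

/-- A bounded fractal string is maximally hyperfractal if every point of the critical line of its
geometric zeta function is a nonremovable singularity. -/
def IsMaximallyHyperfractalString (ℓ : ℕ → ℝ) : Prop :=
  ∀ s₀ : ℂ, s₀.re = geometricAbscissa ℓ →
    IsNonremovableSingularity (geometricZeta ℓ) (geometricAbscissa ℓ) s₀

/-- The distance zeta function `∫_{A_δ} d(x, A)^{s-1} dx` of a bounded set `A ⊆ ℝ`. -/
def distanceZeta (δ : ℝ) (A : Set ℝ) (s : ℂ) : ℂ :=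
  ∫ x in Metric.thickening δ A, ((Metric.infDist x A : ℝ) : ℂ) ^ (s - 1)

/-- The abscissa of (absolute) convergence
`inf {α ≥ 0 : ∫_{A_δ} d(x, A)^{α-1} dx < ∞}` of the distance zeta function. -/
def distanceAbscissa (δ : ℝ) (A : Set ℝ) : ℝ :=
  sInf {α : ℝ | 0 ≤ α ∧ ∫⁻ x in Metric.thickening δ A, Metric.infEDist x A ^ (α - 1) < ⊤}

/-- A bounded set `A ⊆ ℝ` is maximally hyperfractal if every point of the critical line of its
distance zeta function is a nonremovable singularity (for every choice of `δ > 0`). -/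
def IsMaximallyHyperfractalSet (A : Set ℝ) : Prop :=
  ∀ δ > 0, ∀ s₀ : ℂ, s₀.re = distanceAbscissa δ A →
    IsNonremovableSingularity (distanceZeta δ A) (distanceAbscissa δ A) s₀

end FractalZeta

end

/-!
A gap of `C^{(m,a)}` is determined by a word in `m` letters, naming an interval of some step of
the construction, and one of the `m - 1` holes of that interval; it has length `h a ^ n`, where
`n` is the length of the word and `h` the length of the first holes
(`exists_equiv_gaps_scaledCantorSet`). All gaps of all the sets `c_k C^{(m_k,a_k)}` form a
summable family, and `ℓ` is its nonincreasing enumeration. Summing the geometric series over words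
gives, for `Re s > D`,
`ζ_ℓ(s) = ∑ₖ (c_k h_k)^s (m_k - 1) / (1 - m_k^(1 - s/D))` (`hasSum_cantorZeta_tsum`).

*Abscissa and dimensions.* The series converges for real `s > D`, by comparison with `∑ k x^k`.
Conversely the Cantor set with `m = 2` alone contributes `2^n` lengths proportional to
`2^(-n/D)`, which keeps the `r`-dimensional contents with `r < D` from being zero
(`upperExponent_eq`).

*Singularities.* The term with `m` intervals has its poles at `D + 2πinD / log m`. The poles of
different terms may coincide and their residues might cancel. This is excluded at the poles of a
large prime `p` with `n ≠ 0`: the other `m` with that pole are multiples of `p`, hence at least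
`2p`, and the factor `2^(-(m-1)s)` of `c_k^s` makes all terms with `m ≥ 2p` together smaller than
the term of `p` (`cantorZeta_pole_le_tail`, `eventually_tail_lt`). These poles are dense in the
critical line because `log p` is unbounded.

*The set `A_ℓ`.* On a gap of length `b` the distance to the end points is distributed as twice
Lebesgue measure on `(0, b/2)`. So the image of Lebesgue measure on the `δ`-neighborhood of `A_ℓ`
under the distance function is explicit (`map_infDist_thickening`). Its total mass gives the tube
function, and its moments give
`s ζ_A(s) / 2 = δ^s + ∑ⱼ min(ℓ_j / 2, δ)^s` (`hasSum_distanceZeta`), which differs from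
`2^(-s) ζ_ℓ(s)` by an entire function; so the critical line and the singularities of `ζ_ℓ` carry
over.
-/

noncomputable section

namespace FractalZeta

open Filter Topology MeasureTheory Set

/-! ### The gaps of a generalized Cantor set -/

/-- The `i`-th of the `m` similarities of ratio `a` whose images of `[0,1]` are the intervals of
the first step of the construction of `C^{(m,a)}`. -/
def cantorMap (m : ℕ) (a : ℝ) (i : ℕ) (x : ℝ) : ℝ := a * x + (i : ℝ) * (a + holeLength m a)

section Cantor

variable {m : ℕ} {a : ℝ}

theorem holeLength_pos (hm : 2 ≤ m) (hma : m * a < 1) : 0 < holeLength m a := by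
  have : (2 : ℝ) ≤ m := by exact_mod_cast hm
  exact div_pos (by linarith) (by linarith)

theorem holeLength_mul (hm : 2 ≤ m) : ((m : ℝ) - 1) * holeLength m a = 1 - m * a := by
  have : (2 : ℝ) ≤ m := by exact_mod_cast hm
  rw [holeLength, mul_div_cancel₀]
  linarith

theorem cantorMap_injective (ha : 0 < a) (i : ℕ) : Function.Injective (cantorMap m a i) := by
  intro x y h
  simpa [cantorMap, ha.ne'] using h

theorem cantorMap_sub (i : ℕ) (x y : ℝ) :
    cantorMap m a i x - cantorMap m a i y = a * (x - y) := by
  simp only [cantorMap]; ring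

theorem cantorMap_lt_iff (ha : 0 < a) (i : ℕ) {x y : ℝ} :
    cantorMap m a i x < cantorMap m a i y ↔ x < y := by
  simp [cantorMap, ha]

/-- The images of `[0,1]` under different maps are separated by at least one hole. -/
theorem cantorMap_add_holeLength_le (hm : 2 ≤ m) (ha : 0 < a) (hma : m * a < 1) {i j : ℕ}
    (hij : i < j) {x y : ℝ} (hx : x ≤ 1) (hy : 0 ≤ y) :
    cantorMap m a i x + holeLength m a ≤ cantorMap m a j y := by
  have h := holeLength_pos hm hma
  have hij' : (i : ℝ) + 1 ≤ j := by exact_mod_cast hij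
  simp only [cantorMap]
  nlinarith [mul_le_mul_of_nonneg_right hij' (by linarith : 0 ≤ a + holeLength m a),
    mul_le_mul_of_nonneg_left hx ha.le, mul_nonneg ha.le hy]

theorem cantorMap_mem_Icc (hm : 2 ≤ m) (ha : 0 < a) (hma : m * a < 1) {i : ℕ} (hi : i < m)
    {x : ℝ} (hx : x ∈ Icc (0 : ℝ) 1) : cantorMap m a i x ∈ Icc (0 : ℝ) 1 := by
  have h := holeLength_pos hm hma
  have hi' : (i : ℝ) ≤ m - 1 := by
    have : (i : ℝ) + 1 ≤ m := by exact_mod_cast hi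
    linarith
  have h1 := holeLength_mul (a := a) hm
  have h2 : a * x ≤ a * 1 := mul_le_mul_of_nonneg_left hx.2 ha.le
  have h3 := mul_le_mul_of_nonneg_right hi' (by linarith : 0 ≤ a + holeLength m a)
  have h4 : 0 ≤ a * x := mul_nonneg ha.le hx.1
  simp only [cantorMap]
  exact ⟨by positivity, by nlinarith⟩

theorem cantorMap_index_unique (hm : 2 ≤ m) (ha : 0 < a) (hma : m * a < 1) {i j : ℕ} {x y : ℝ}
    (hx : x ∈ Icc (0 : ℝ) 1) (hy : y ∈ Icc (0 : ℝ) 1)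
    (h : cantorMap m a i x = cantorMap m a j y) : i = j := by
  have h0 := holeLength_pos hm hma
  rcases lt_trichotomy i j with hij | hij | hij
  · have := cantorMap_add_holeLength_le hm ha hma hij hx.2 hy.1
    linarith
  · exact hij
  · have := cantorMap_add_holeLength_le hm ha hma hij hy.2 hx.1
    linarith

theorem mem_cantorStep_succ {n : ℕ} {x : ℝ} :
    x ∈ cantorStep m a (n + 1) ↔ ∃ i < m, ∃ y ∈ cantorStep m a n, cantorMap m a i y = x := by
  simp only [cantorStep, mem_iUnion, mem_image, cantorMap]
  exact ⟨fun ⟨i, y, hy, h⟩ => ⟨i, i.2, y, hy, h⟩, fun ⟨i, hi, y, hy, h⟩ => ⟨⟨i, hi⟩, y, hy, h⟩⟩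

theorem cantorStep_subset_Icc (hm : 2 ≤ m) (ha : 0 < a) (hma : m * a < 1) (n : ℕ) :
    cantorStep m a n ⊆ Icc 0 1 := by
  induction n with
  | zero => exact subset_rfl
  | succ n ih =>
    intro x hx
    obtain ⟨i, hi, y, hy, rfl⟩ := mem_cantorStep_succ.1 hx
    exact cantorMap_mem_Icc hm ha hma hi (ih hy)

theorem generalizedCantorSet_subset_Icc : generalizedCantorSet m a ⊆ Icc 0 1 :=
  iInter_subset (cantorStep m a) 0

theorem mem_generalizedCantorSet {x : ℝ} :
    x ∈ generalizedCantorSet m a ↔ ∀ n, x ∈ cantorStep m a n := mem_iInter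

/-- Self-similarity of the generalized Cantor set: it is the union of its images under the maps
`cantorMap m a i`. -/
theorem mem_generalizedCantorSet_iff (hm : 2 ≤ m) (ha : 0 < a) (hma : m * a < 1) {x : ℝ} :
    x ∈ generalizedCantorSet m a ↔
      ∃ i < m, ∃ y ∈ generalizedCantorSet m a, cantorMap m a i y = x := by
  constructor
  · intro hx
    rw [mem_generalizedCantorSet] at hx
    obtain ⟨i, hi, y, hy, hyx⟩ := mem_cantorStep_succ.1 (hx 1)
    refine ⟨i, hi, y, mem_generalizedCantorSet.2 fun n => ?_, hyx⟩
    obtain ⟨j, hj, z, hz, hzx⟩ := mem_cantorStep_succ.1 (hx (n + 1))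
    have hij := cantorMap_index_unique hm ha hma (cantorStep_subset_Icc hm ha hma n hz) hy
      (hzx.trans hyx.symm)
    subst hij
    exact cantorMap_injective ha j (hzx.trans hyx.symm) ▸ hz
  · rintro ⟨i, hi, y, hy, rfl⟩
    refine mem_generalizedCantorSet.2 fun n => ?_
    cases n with
    | zero => exact cantorMap_mem_Icc hm ha hma hi (generalizedCantorSet_subset_Icc hy)
    | succ n => exact mem_cantorStep_succ.2 ⟨i, hi, y, mem_generalizedCantorSet.1 hy n, rfl⟩

theorem zero_mem_generalizedCantorSet (hm : 2 ≤ m) : (0 : ℝ) ∈ generalizedCantorSet m a := by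
  refine mem_generalizedCantorSet.2 fun n => ?_
  induction n with
  | zero => simp [cantorStep]
  | succ n ih => exact mem_cantorStep_succ.2 ⟨0, by omega, 0, ih, by simp [cantorMap]⟩

theorem one_mem_generalizedCantorSet (hm : 2 ≤ m) : (1 : ℝ) ∈ generalizedCantorSet m a := by
  refine mem_generalizedCantorSet.2 fun n => ?_
  induction n with
  | zero => simp [cantorStep]
  | succ n ih =>
    refine mem_cantorStep_succ.2 ⟨m - 1, by omega, 1, ih, ?_⟩
    have h1 := holeLength_mul (a := a) hm
    rw [cantorMap, Nat.cast_sub (by omega), Nat.cast_one]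
    linarith

/-- The gaps of `C^{(m,a)}`, encoded by words: the word `w` selects one of the intervals of step
`w.length`, and `i` one of its `m - 1` holes. -/
def cantorGap (m : ℕ) (a : ℝ) : List (Fin m) → Fin (m - 1) → ℝ × ℝ
  | [], i => (cantorMap m a i 1, cantorMap m a (i + 1) 0)
  | j :: w, i => Prod.map (cantorMap m a j) (cantorMap m a j) (cantorGap m a w i)

theorem cantorGap_length (w : List (Fin m)) (i : Fin (m - 1)) :
    (cantorGap m a w i).2 - (cantorGap m a w i).1 = holeLength m a * a ^ w.length := by
  induction w with
  | nil =>
    simp only [cantorGap, cantorMap, List.length_nil]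
    push_cast
    ring
  | cons j w ih =>
    simp only [cantorGap, Prod.map_fst, Prod.map_snd, cantorMap_sub, ih, List.length_cons]
    ring

theorem cantorGap_mem_gaps (hm : 2 ≤ m) (ha : 0 < a) (hma : m * a < 1) (w : List (Fin m))
    (i : Fin (m - 1)) : cantorGap m a w i ∈ gaps (generalizedCantorSet m a) := by
  have h0 := holeLength_pos hm hma
  have hlt : (cantorGap m a w i).1 < (cantorGap m a w i).2 := by
    have := cantorGap_length (a := a) w i
    have : 0 < holeLength m a * a ^ w.length := by positivity
    linarith
  have hK {x : ℝ} := mem_generalizedCantorSet_iff hm ha hma (x := x)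
  induction w with
  | nil =>
    refine ⟨hK.2 ⟨i, by omega, 1, one_mem_generalizedCantorSet hm, rfl⟩,
      hK.2 ⟨i + 1, by omega, 0, zero_mem_generalizedCantorSet hm, rfl⟩, hlt, ?_⟩
    rw [Set.disjoint_left]
    rintro x ⟨hx1, hx2⟩ hx
    obtain ⟨j, hj, y, hy, rfl⟩ := hK.1 hx
    have hy' := generalizedCantorSet_subset_Icc hy
    simp only [cantorGap] at hx1 hx2
    rcases Nat.lt_or_ge (i : ℕ) j with hij | hij
    · rcases (Nat.succ_le_of_lt hij).eq_or_lt with h | h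
      · subst h
        have := (cantorMap_lt_iff ha _).1 hx2
        linarith [hy'.1]
      · have := cantorMap_add_holeLength_le hm ha hma h zero_le_one hy'.1
        simp only [Nat.succ_eq_add_one] at this
        linarith
    · rcases hij.eq_or_lt with h | h
      · subst h
        have := (cantorMap_lt_iff ha _).1 hx1
        linarith [hy'.2]
      · have := cantorMap_add_holeLength_le hm ha hma h hy'.2 zero_le_one
        linarith
  | cons j w ih =>
    simp only [cantorGap, Prod.map_fst, Prod.map_snd, cantorMap_lt_iff ha] at hlt
    obtain ⟨h1, h2, -, h4⟩ := ih hlt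
    have b1 := generalizedCantorSet_subset_Icc h1
    have b2 := generalizedCantorSet_subset_Icc h2
    refine ⟨hK.2 ⟨j, j.2, _, h1, rfl⟩, hK.2 ⟨j, j.2, _, h2, rfl⟩, ?_, ?_⟩
    · simpa only [cantorGap, Prod.map_fst, Prod.map_snd, cantorMap_lt_iff ha] using hlt
    rw [Set.disjoint_left]
    rintro x ⟨hx1, hx2⟩ hx
    obtain ⟨l, hl, y, hy, rfl⟩ := hK.1 hx
    have hy' := generalizedCantorSet_subset_Icc hy
    simp only [cantorGap, Prod.map_fst, Prod.map_snd] at hx1 hx2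
    rcases lt_trichotomy l j with hij | hij | hij
    · have := cantorMap_add_holeLength_le hm ha hma hij hy'.2 b1.1
      linarith
    · subst hij
      exact Set.disjoint_left.1 h4 ⟨(cantorMap_lt_iff ha _).1 hx1, (cantorMap_lt_iff ha _).1 hx2⟩ hy
    · have := cantorMap_add_holeLength_le hm ha hma hij b2.2 hy'.1
      linarith

theorem cantorGap_injective (hm : 2 ≤ m) (ha : 0 < a) (hma : m * a < 1) :
    Function.Injective fun q : List (Fin m) × Fin (m - 1) => cantorGap m a q.1 q.2 := by
  have mem := cantorGap_mem_gaps hm ha hma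
  have bd1 : ∀ w i, (cantorGap m a w i).1 ∈ Icc (0 : ℝ) 1 := fun w i =>
    generalizedCantorSet_subset_Icc (mem w i).1
  have bd2 : ∀ w i, (cantorGap m a w i).2 ∈ Icc (0 : ℝ) 1 := fun w i =>
    generalizedCantorSet_subset_Icc (mem w i).2.1
  have h01 : (0 : ℝ) ∈ Icc (0 : ℝ) 1 := by simp
  have h11 : (1 : ℝ) ∈ Icc (0 : ℝ) 1 := by simp
  -- The end points of a hole of the first step lie in two different intervals of that step.
  have key : ∀ (i : Fin (m - 1)) (j : Fin m) (w : List (Fin m)) (i' : Fin (m - 1)),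
      cantorGap m a [] i ≠ cantorGap m a (j :: w) i' := by
    intro i j w i' h
    simp only [cantorGap, Prod.ext_iff, Prod.map_fst, Prod.map_snd] at h
    have e1 := cantorMap_index_unique hm ha hma h11 (bd1 w i') h.1
    have e2 := cantorMap_index_unique hm ha hma h01 (bd2 w i') h.2
    omega
  rintro ⟨w, i⟩ ⟨w', i'⟩ h
  simp only at h
  induction w generalizing w' with
  | nil =>
    cases w' with
    | nil =>
      have e1 := cantorMap_index_unique hm ha hma h11 h11 (congrArg Prod.fst h)
      simp [Fin.ext_iff, e1]
    | cons j w' => exact (key _ _ _ _ h).elim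
  | cons j w ih =>
    cases w' with
    | nil => exact (key _ _ _ _ h.symm).elim
    | cons j' w' =>
      simp only [cantorGap, Prod.ext_iff, Prod.map_fst, Prod.map_snd] at h
      have e1 := cantorMap_index_unique hm ha hma (bd1 w i) (bd1 w' i') h.1
      rw [e1] at h
      have := ih w' (Prod.ext (cantorMap_injective ha _ h.1) (cantorMap_injective ha _ h.2))
      simp only [Prod.mk.injEq] at this ⊢
      exact ⟨by rw [this.1, Fin.ext e1], this.2⟩

/-- Every gap is a `cantorGap`: a gap of length more than `a ^ n` is a hole of one of the first
`n` steps. -/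
theorem exists_cantorGap_eq (hm : 2 ≤ m) (ha : 0 < a) (hma : m * a < 1) {p : ℝ × ℝ}
    (hp : p ∈ gaps (generalizedCantorSet m a)) : ∃ w i, cantorGap m a w i = p := by
  have h0 := holeLength_pos hm hma
  have hK {x : ℝ} := mem_generalizedCantorSet_iff hm ha hma (x := x)
  have ha1 : a < 1 := by
    have : (2 : ℝ) ≤ m := by exact_mod_cast hm
    nlinarith
  obtain ⟨n, hn⟩ := exists_pow_lt_of_lt_one (sub_pos.2 hp.2.2.1) ha1
  induction n generalizing p with
  | zero =>
    have b1 := generalizedCantorSet_subset_Icc hp.1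
    have b2 := generalizedCantorSet_subset_Icc hp.2.1
    simp only [pow_zero] at hn
    linarith [b1.1, b2.2]
  | succ n ih =>
    obtain ⟨u, v⟩ := p
    obtain ⟨hu, hv, hlt, hd⟩ := hp
    simp only at hu hv hlt hd hn
    obtain ⟨i, hi, x, hx, rfl⟩ := hK.1 hu
    obtain ⟨j, hj, y, hy, rfl⟩ := hK.1 hv
    have bx := generalizedCantorSet_subset_Icc hx
    have bY := generalizedCantorSet_subset_Icc hy
    rcases lt_trichotomy i j with hij | hij | hij
    · -- The gap must be the hole following the `i`-th interval, as it contains that hole.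
      refine ⟨[], ⟨i, by omega⟩, ?_⟩
      have k1 : cantorMap m a i 1 ∈ generalizedCantorSet m a :=
        hK.2 ⟨i, hi, 1, one_mem_generalizedCantorSet hm, rfl⟩
      have k2 : cantorMap m a (i + 1) 0 ∈ generalizedCantorSet m a :=
        hK.2 ⟨i + 1, by omega, 0, zero_mem_generalizedCantorSet hm, rfl⟩
      have l1 : cantorMap m a i x ≤ cantorMap m a i 1 := by
        by_contra! h
        linarith [(cantorMap_lt_iff ha _).1 h, bx.2]
      have l2 := cantorMap_add_holeLength_le hm ha hma (Nat.lt_succ_self i) (le_refl (1 : ℝ))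
        (le_refl (0 : ℝ))
      have l3 : cantorMap m a (i + 1) 0 ≤ cantorMap m a j y := by
        rcases (Nat.succ_le_of_lt hij).eq_or_lt with h | h
        · subst h
          by_contra! h
          linarith [(cantorMap_lt_iff ha _).1 h, bY.1]
        · have := cantorMap_add_holeLength_le hm ha hma h zero_le_one bY.1
          simp only [Nat.succ_eq_add_one] at this
          linarith
      simp only [Nat.succ_eq_add_one] at l2
      simp only [cantorGap, Prod.mk.injEq]
      constructor
      · by_contra h
        exact Set.disjoint_left.1 hd ⟨lt_of_le_of_ne l1 (Ne.symm h), by linarith⟩ k1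
      · by_contra h
        exact Set.disjoint_left.1 hd ⟨by linarith, lt_of_le_of_ne l3 h⟩ k2
    · subst hij
      have hxy := (cantorMap_lt_iff ha _).1 hlt
      rw [cantorMap_sub, pow_succ', mul_lt_mul_iff_right₀ ha] at hn
      have hg : (x, y) ∈ gaps (generalizedCantorSet m a) := by
        refine ⟨hx, hy, hxy, Set.disjoint_left.2 fun z hz hzK => ?_⟩
        exact Set.disjoint_left.1 hd
          ⟨(cantorMap_lt_iff ha i).2 hz.1, (cantorMap_lt_iff ha i).2 hz.2⟩ (hK.2 ⟨i, hi, z, hzK, rfl⟩)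
      obtain ⟨w, l, hw⟩ := ih hg hn
      exact ⟨⟨i, hi⟩ :: w, l, by simp [cantorGap, hw]⟩
    · have := cantorMap_add_holeLength_le hm ha hma hij bY.2 bx.1
      linarith

theorem gaps_image_mul {c : ℝ} (hc : 0 < c) (K : Set ℝ) (p : ℝ × ℝ) :
    (c * p.1, c * p.2) ∈ gaps ((fun x => c * x) '' K) ↔ p ∈ gaps K := by
  have hinj : Function.Injective fun x : ℝ => c * x := mul_right_injective₀ hc.ne'
  simp only [gaps, mem_ofPred_eq, mul_lt_mul_iff_right₀ hc]
  rw [hinj.mem_set_image (a := p.1), hinj.mem_set_image (a := p.2)]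
  refine and_congr_right fun _ => and_congr_right fun _ => and_congr_right fun _ => ?_
  simp only [Set.disjoint_left]
  constructor
  · intro h x hx hxK
    exact h (a := c * x) ⟨(mul_lt_mul_iff_right₀ hc).2 hx.1, (mul_lt_mul_iff_right₀ hc).2 hx.2⟩
      ⟨x, hxK, rfl⟩
  · rintro h _ hx ⟨x, hxK, rfl⟩
    exact h ⟨(mul_lt_mul_iff_right₀ hc).1 hx.1, (mul_lt_mul_iff_right₀ hc).1 hx.2⟩ hxK

/-- The gaps of `c C^{(m,a)}` are in bijection with the pairs of a word and a hole; the gap of the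
word `w` has length `c h a ^ w.length`. -/
theorem exists_equiv_gaps_scaledCantorSet (hm : 2 ≤ m) (ha : 0 < a) (hma : m * a < 1) {c : ℝ}
    (hc : 0 < c) :
    ∃ e : List (Fin m) × Fin (m - 1) ≃ gaps (scaledCantorSet c m a),
      ∀ q, (e q).1.2 - (e q).1.1 = c * holeLength m a * a ^ q.1.length := by
  let f : List (Fin m) × Fin (m - 1) → gaps (scaledCantorSet c m a) := fun q =>
    ⟨(c * (cantorGap m a q.1 q.2).1, c * (cantorGap m a q.1 q.2).2),
      (gaps_image_mul hc _ _).2 (cantorGap_mem_gaps hm ha hma q.1 q.2)⟩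
  have hf : Function.Bijective f := by
    constructor
    · intro q q' h
      have h' := congrArg Subtype.val h
      simp only [f, Prod.mk.injEq, mul_right_inj' hc.ne'] at h'
      exact cantorGap_injective hm ha hma (Prod.ext h'.1 h'.2)
    · rintro ⟨⟨u, v⟩, hp⟩
      obtain ⟨x, hx, hxu⟩ := hp.1
      obtain ⟨y, hy, hyv⟩ := hp.2.1
      simp only at hxu hyv
      subst hxu hyv
      obtain ⟨w, i, hw⟩ := exists_cantorGap_eq hm ha hma ((gaps_image_mul hc _ (x, y)).1 hp)
      exact ⟨(w, i), by simp [f, hw]⟩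
  refine ⟨Equiv.ofBijective f hf, fun q => ?_⟩
  simp only [Equiv.ofBijective_apply, f]
  rw [← mul_sub, cantorGap_length]
  ring

end Cantor

/-! ### Nonincreasing enumeration of summable families -/

/-- A summable family of positive numbers can be listed in nonincreasing order. -/
theorem exists_equiv_nat_antitone {ι : Type*} [Countable ι] [Infinite ι] {f : ι → ℝ}
    (hpos : ∀ i, 0 < f i) (hf : Summable f) : ∃ e : ℕ ≃ ι, Antitone fun n => f (e n) := by
  classical
  obtain ⟨g, hg⟩ := exists_injective_nat ι
  -- Order `ι` by decreasing values, with ties broken by `g`; every element has finitely many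
  -- predecessors, and counting them embeds `ι` monotonically into `ℕ`.
  let B : ι → Set ι := fun i => {j | f i < f j ∨ (f i = f j ∧ g j < g i)}
  have hBfin : ∀ i, (B i).Finite := by
    intro i
    have h1 : ∀ᶠ j in cofinite, f j < f i :=
      hf.tendsto_cofinite_zero.eventually (gt_mem_nhds (hpos i))
    refine (Filter.eventually_cofinite.1 h1).subset fun j hj => ?_
    rcases hj with hj | hj
    · exact not_lt.2 hj.le
    · exact not_lt.2 hj.1.le
  have hlt : ∀ i j, j ∈ B i → (B j).ncard < (B i).ncard := by
    intro i j hj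
    refine Set.ncard_lt_ncard ⟨fun l hl => ?_, fun h => ?_⟩ (hBfin i)
    · rcases hj with hj | hj <;> rcases hl with hl | hl
      · exact Or.inl (hj.trans hl)
      · exact Or.inl (hl.1 ▸ hj)
      · exact Or.inl (hj.1 ▸ hl)
      · exact Or.inr ⟨hj.1.trans hl.1, hl.2.trans hj.2⟩
    · rcases h hj with h | h
      · exact lt_irrefl _ h
      · exact lt_irrefl _ h.2
  have hinj : Function.Injective fun i => (B i).ncard := by
    intro i j hij
    by_contra hne
    rcases lt_trichotomy (f i) (f j) with h | h | h
    · exact (hlt i j (Or.inl h)).ne' hij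
    · rcases lt_or_gt_of_ne (hg.ne hne) with h' | h'
      · exact (hlt j i (Or.inr ⟨h.symm, h'⟩)).ne hij
      · exact (hlt i j (Or.inr ⟨h, h'⟩)).ne' hij
    · exact (hlt j i (Or.inl h)).ne hij
  let s : Set ℕ := range fun i => (B i).ncard
  have hs : Infinite s := (Set.infinite_range_of_injective hinj).to_subtype
  let o : ℕ ≃o s := Nat.Subtype.orderIsoOfNat s
  let e' : ι ≃ s := Equiv.ofInjective _ hinj
  refine ⟨o.toEquiv.trans e'.symm, fun a b hab => ?_⟩
  by_contra! h
  have h1 := hlt _ _ (Or.inl h : (e'.symm (o b)) ∈ B (e'.symm (o a)))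
  have h2 : ∀ x : s, (B (e'.symm x)).ncard = x := fun x =>
    congrArg Subtype.val (e'.apply_symm_apply x)
  rw [h2, h2] at h1
  exact absurd (o.monotone hab) (not_le.2 h1)

/-! ### The family of all gap lengths -/

/-- The scaling ratio `m ^ (-1/D)`, `m = k + 2`, of the `k`-th Cantor set. -/
def ratio (D : ℝ) (k : ℕ) : ℝ := ((k + 2 : ℕ) : ℝ) ^ (-(1 / D))

/-- The length of the largest gaps of the `k`-th scaled Cantor set. -/
def firstGap (D : ℝ) (k : ℕ) : ℝ := (1 / 2 : ℝ) ^ (k + 1) * holeLength (k + 2) (ratio D k)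

/-- The gaps of all the scaled Cantor sets: a number `k`, a word and a hole. -/
abbrev GapIndex : Type := Σ k : ℕ, List (Fin (k + 2)) × Fin (k + 2 - 1)

/-- The length of a gap. -/
def gapLength (D : ℝ) (q : GapIndex) : ℝ := firstGap D q.1 * ratio D q.1 ^ q.2.1.length

/-- The geometric zeta function of the string of the `k`-th scaled Cantor set, in closed form. -/
def cantorZeta (D : ℝ) (k : ℕ) (s : ℂ) : ℂ :=
  (firstGap D k : ℂ) ^ s * (k + 1) / (1 - (k + 2) * (ratio D k : ℂ) ^ s)

section GapFamily

variable {D : ℝ}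

theorem ratio_pos (D : ℝ) (k : ℕ) : 0 < ratio D k := by
  unfold ratio; positivity

theorem ratio_rpow (D : ℝ) (k : ℕ) (α : ℝ) :
    ((k : ℝ) + 2) * ratio D k ^ α = ((k : ℝ) + 2) ^ (1 - α / D) := by
  have : (0 : ℝ) < (k : ℝ) + 2 := by positivity
  rw [ratio, ← Real.rpow_mul (by positivity), Real.rpow_sub this, Real.rpow_one]
  push_cast
  rw [show -(1 / D) * α = -(α / D) by ring, Real.rpow_neg this.le]
  rfl

theorem mul_ratio_lt_one (hD : 0 < D ∧ D < 1) (k : ℕ) : ((k + 2 : ℕ) : ℝ) * ratio D k < 1 := by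
  have h := ratio_rpow D k 1
  rw [Real.rpow_one] at h
  push_cast
  rw [h]
  refine Real.rpow_lt_one_of_one_lt_of_neg ?_ ?_
  · have : (0 : ℝ) ≤ k := by positivity
    linarith
  · have := (one_lt_div hD.1).2 hD.2
    linarith

theorem holeLength_ratio_pos (hD : 0 < D ∧ D < 1) (k : ℕ) : 0 < holeLength (k + 2) (ratio D k) :=
  holeLength_pos (by omega) (mul_ratio_lt_one hD k)

theorem firstGap_pos (hD : 0 < D ∧ D < 1) (k : ℕ) : 0 < firstGap D k := by
  have := holeLength_ratio_pos hD k
  unfold firstGap; positivity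

theorem firstGap_le (hD : 0 < D ∧ D < 1) (k : ℕ) : firstGap D k ≤ (1 / 2 : ℝ) ^ (k + 1) := by
  have h1 := holeLength_mul (m := k + 2) (a := ratio D k) (by omega)
  have h2 := holeLength_ratio_pos hD k
  have h3 : 0 < ((k + 2 : ℕ) : ℝ) * ratio D k := mul_pos (by positivity) (ratio_pos D k)
  have h4 : holeLength (k + 2) (ratio D k) ≤ 1 := by
    have h5 : (0 : ℝ) ≤ k := by positivity
    push_cast at h1 h3
    nlinarith [mul_nonneg h5 h2.le]
  exact mul_le_of_le_one_right (by positivity) h4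

theorem gapLength_pos (hD : 0 < D ∧ D < 1) (q : GapIndex) : 0 < gapLength D q :=
  mul_pos (firstGap_pos hD _) (pow_pos (ratio_pos D _) _)

theorem ofReal_mul_pow_cpow {x y : ℝ} (hx : 0 < x) (hy : 0 < y) (n : ℕ) (s : ℂ) :
    ((x * y ^ n : ℝ) : ℂ) ^ s = (x : ℂ) ^ s * ((y : ℂ) ^ s) ^ n := by
  have h : ∀ n : ℕ, ((y ^ n : ℝ) : ℂ) ^ s = ((y : ℂ) ^ s) ^ n := by
    intro n
    induction n with
    | zero => simp
    | succ n ih =>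
      rw [pow_succ, pow_succ, Complex.ofReal_mul,
        Complex.mul_cpow_ofReal_nonneg (by positivity) hy.le, ih]
  rw [Complex.ofReal_mul, Complex.mul_cpow_ofReal_nonneg hx.le (by positivity), h]

theorem hasSum_const_words {𝕜 : Type*} [RCLike 𝕜] (m n : ℕ) (z : 𝕜) :
    HasSum (fun _ : Fin n → Fin m => z ^ n) ((m * z) ^ n) := by
  convert hasSum_fintype (fun _ : Fin n → Fin m => z ^ n) using 1
  simp [mul_pow]

/-- The generating series of words over an alphabet with `m` letters. -/
theorem hasSum_pow_length {𝕜 : Type*} [RCLike 𝕜] (m : ℕ) {z : 𝕜} (hz : m * ‖z‖ < 1) :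
    HasSum (fun w : List (Fin m) => z ^ w.length) (1 - m * z)⁻¹ := by
  have hs : Summable fun x : Σ n, Fin n → Fin m => z ^ x.1 := by
    refine Summable.of_norm ?_
    simp only [norm_pow]
    refine (summable_sigma_of_nonneg fun _ => by positivity).2
      ⟨fun n => (hasSum_const_words m n ‖z‖).summable, ?_⟩
    simp only [fun n => (hasSum_const_words m n ‖z‖).tsum_eq]
    exact summable_geometric_of_lt_one (by positivity) hz
  have hg : HasSum (fun n : ℕ => ((m : 𝕜) * z) ^ n) (1 - m * z)⁻¹ :=
    hasSum_geometric_of_norm_lt_one (by simpa using hz)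
  have := hg.sigma_of_hasSum (fun n => hasSum_const_words m n z) hs
  rw [← List.equivSigmaTuple.hasSum_iff] at this
  exact this

theorem hasSum_pow_length_prod {𝕜 : Type*} [RCLike 𝕜] (m l : ℕ) {z : 𝕜} (hz : m * ‖z‖ < 1) :
    HasSum (fun x : List (Fin m) × Fin l => z ^ x.1.length) (l * (1 - m * z)⁻¹) := by
  have hs : Summable fun x : Σ _ : List (Fin m), Fin l => z ^ x.1.length := by
    refine Summable.of_norm ?_
    simp only [norm_pow]
    have hz' : (m : ℝ) * ‖‖z‖‖ < 1 := by rwa [norm_norm]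
    refine (summable_sigma_of_nonneg fun _ => by positivity).2
      ⟨fun w => (hasSum_fintype _).summable, ?_⟩
    simpa using ((hasSum_pow_length m hz').mul_left (l : ℝ)).summable
  have h := ((hasSum_pow_length m hz).mul_left (l : 𝕜)).sigma_of_hasSum
    (f := fun x : Σ _ : List (Fin m), Fin l => z ^ x.1.length) (fun w => ?_) hs
  · rw [← (Equiv.sigmaEquivProd (List (Fin m)) (Fin l)).hasSum_iff]
    exact h
  · have h' := hasSum_fintype (fun _ : Fin l => z ^ w.length)
    rwa [Finset.sum_const, Finset.card_univ, Fintype.card_fin, nsmul_eq_mul] at h'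

/-- The closed form of the geometric zeta function of one scaled Cantor set. -/
theorem hasSum_cantorZeta (hD : 0 < D ∧ D < 1) (k : ℕ) {s : ℂ} (hs : D < s.re) :
    HasSum (fun x : List (Fin (k + 2)) × Fin (k + 2 - 1) => (gapLength D ⟨k, x⟩ : ℂ) ^ s)
      (cantorZeta D k s) := by
  have hz : ((k + 2 : ℕ) : ℝ) * ‖(ratio D k : ℂ) ^ s‖ < 1 := by
    rw [Complex.norm_cpow_eq_rpow_re_of_pos (ratio_pos D k)]
    push_cast
    rw [ratio_rpow]
    refine Real.rpow_lt_one_of_one_lt_of_neg ?_ ?_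
    · have : (0 : ℝ) ≤ k := by positivity
      linarith
    · have := (one_lt_div hD.1).2 hs
      linarith
  have h1 := (hasSum_pow_length_prod (k + 2) (k + 2 - 1) hz).mul_left ((firstGap D k : ℂ) ^ s)
  have e1 : (fun x : List (Fin (k + 2)) × Fin (k + 2 - 1) => (gapLength D ⟨k, x⟩ : ℂ) ^ s) =
      fun x => (firstGap D k : ℂ) ^ s * ((ratio D k : ℂ) ^ s) ^ x.1.length := by
    funext x
    exact ofReal_mul_pow_cpow (firstGap_pos hD k) (ratio_pos D k) _ s
  have e2 : cantorZeta D k s = (firstGap D k : ℂ) ^ s *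
      (((k + 2 - 1 : ℕ) : ℂ) * (1 - ((k + 2 : ℕ) : ℂ) * (ratio D k : ℂ) ^ s)⁻¹) := by
    simp [cantorZeta, div_eq_mul_inv, mul_assoc]
  rw [e1, e2]
  exact h1

theorem hasSum_gapLength_rpow (hD : 0 < D ∧ D < 1) (k : ℕ) {α : ℝ} (hα : D < α) :
    HasSum (fun x : List (Fin (k + 2)) × Fin (k + 2 - 1) => gapLength D ⟨k, x⟩ ^ α)
      (firstGap D k ^ α * ((k + 1) * (1 - (k + 2 : ℝ) ^ (1 - α / D))⁻¹)) := by
  have hz : ((k + 2 : ℕ) : ℝ) * ‖ratio D k ^ α‖ < 1 := by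
    rw [Real.norm_of_nonneg (Real.rpow_nonneg (ratio_pos D k).le _)]
    push_cast
    rw [ratio_rpow]
    refine Real.rpow_lt_one_of_one_lt_of_neg ?_ ?_
    · have : (0 : ℝ) ≤ k := by positivity
      linarith
    · have := (one_lt_div hD.1).2 hα
      linarith
  have h1 := (hasSum_pow_length_prod (k + 2) (k + 2 - 1) hz).mul_left (firstGap D k ^ α)
  have e1 : (fun x : List (Fin (k + 2)) × Fin (k + 2 - 1) => gapLength D ⟨k, x⟩ ^ α) =
      fun x => firstGap D k ^ α * (ratio D k ^ α) ^ x.1.length := by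
    funext x
    rw [gapLength, Real.mul_rpow (firstGap_pos hD k).le (pow_pos (ratio_pos D k) _).le,
      ← Real.rpow_natCast, ← Real.rpow_mul (ratio_pos D k).le, mul_comm _ α,
      Real.rpow_mul (ratio_pos D k).le, Real.rpow_natCast]
  have e2 : firstGap D k ^ α * ((k + 1) * (1 - (k + 2 : ℝ) ^ (1 - α / D))⁻¹) = firstGap D k ^ α *
      (((k + 2 - 1 : ℕ) : ℝ) * (1 - ((k + 2 : ℕ) : ℝ) * ratio D k ^ α)⁻¹) := by
    push_cast
    rw [ratio_rpow]
  rw [e1, e2]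
  exact h1

theorem summable_gapLength_rpow (hD : 0 < D ∧ D < 1) {α : ℝ} (hα : D < α) :
    Summable fun q => gapLength D q ^ α := by
  have hα0 : 0 < α := hD.1.trans hα
  have hneg : 1 - α / D < 0 := by
    have := (one_lt_div hD.1).2 hα
    linarith
  refine (summable_sigma_of_nonneg fun q => Real.rpow_nonneg (gapLength_pos hD q).le _).2
    ⟨fun k => (hasSum_gapLength_rpow hD k hα).summable, ?_⟩
  simp only [fun k => (hasSum_gapLength_rpow hD k hα).tsum_eq]
  set r : ℝ := (1 / 2 : ℝ) ^ α with hr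
  have hr0 : 0 ≤ r := by positivity
  have hr1 : r < 1 := Real.rpow_lt_one (by norm_num) (by norm_num) hα0
  set C : ℝ := (1 - (2 : ℝ) ^ (1 - α / D))⁻¹ with hC
  have h2 : (2 : ℝ) ^ (1 - α / D) < 1 := Real.rpow_lt_one_of_one_lt_of_neg (by norm_num) hneg
  have hsum : Summable fun k : ℕ => ((k + 1 : ℕ) : ℝ) * r ^ (k + 1) * C := by
    have := summable_pow_mul_geometric_of_norm_lt_one 1
      (r := r) (by rwa [Real.norm_of_nonneg hr0])
    simp only [pow_one] at this
    exact ((summable_nat_add_iff 1).2 this).mul_right C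
  have hden : ∀ k : ℕ, (k + 2 : ℝ) ^ (1 - α / D) ≤ (2 : ℝ) ^ (1 - α / D) := fun k =>
    Real.rpow_le_rpow_of_nonpos (by norm_num)
      (by have : (0 : ℝ) ≤ k := by positivity
          linarith) hneg.le
  have hinv : ∀ k : ℕ, 0 ≤ (1 - (k + 2 : ℝ) ^ (1 - α / D))⁻¹ := fun k =>
    inv_nonneg.2 (by linarith [hden k])
  refine Summable.of_nonneg_of_le (fun k => ?_) (fun k => ?_) hsum
  · exact mul_nonneg (Real.rpow_nonneg (firstGap_pos hD k).le _)
      (mul_nonneg (by positivity) (hinv k))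
  · have e1 : firstGap D k ^ α ≤ r ^ (k + 1) := by
      refine (Real.rpow_le_rpow (firstGap_pos hD k).le (firstGap_le hD k) hα0.le).trans_eq ?_
      rw [hr, ← Real.rpow_natCast, ← Real.rpow_natCast, ← Real.rpow_mul (by norm_num),
        ← Real.rpow_mul (by norm_num), mul_comm]
    have e2 : (1 - (k + 2 : ℝ) ^ (1 - α / D))⁻¹ ≤ C :=
      inv_anti₀ (by linarith) (by linarith [hden k])
    calc firstGap D k ^ α * ((k + 1) * (1 - (k + 2 : ℝ) ^ (1 - α / D))⁻¹)
        ≤ r ^ (k + 1) * ((k + 1) * C) := by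
          gcongr
          exact mul_nonneg (by positivity) (hinv k)
      _ = _ := by push_cast; ring

/-- To the right of `D` the geometric zeta function of the whole family is the sum of the closed
forms for the individual Cantor sets. -/
theorem hasSum_cantorZeta_tsum (hD : 0 < D ∧ D < 1) {s : ℂ} (hs : D < s.re) :
    HasSum (fun k => cantorZeta D k s) (∑' q, (gapLength D q : ℂ) ^ s) := by
  have hsum : Summable fun q => (gapLength D q : ℂ) ^ s := by
    refine Summable.of_norm ?_
    simp only [fun q => Complex.norm_cpow_eq_rpow_re_of_pos (gapLength_pos hD q) s]
    exact summable_gapLength_rpow hD hs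
  exact hsum.hasSum.sigma fun k => hasSum_cantorZeta hD k hs

/-- The string of the first Cantor set, with `m = 2`, has at least `2 ^ n` lengths of level `n`. -/
theorem exists_finset_gapLength_eq (D : ℝ) (n : ℕ) :
    ∃ S : Finset GapIndex, S.card = 2 ^ n ∧
      ∀ q ∈ S, gapLength D q = firstGap D 0 * ratio D 0 ^ n := by
  let f : (Fin n → Fin 2) ↪ GapIndex :=
    ⟨fun v => ⟨0, List.ofFn v, 0⟩, fun v v' h => by
      simp only [Sigma.mk.injEq, heq_eq_eq, Prod.mk.injEq, true_and, and_true] at h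
      exact List.ofFn_injective h⟩
  refine ⟨Finset.univ.map f, by simp, fun q hq => ?_⟩
  obtain ⟨v, -, rfl⟩ := Finset.mem_map.1 hq
  change firstGap D 0 * ratio D 0 ^ (List.ofFn v).length = _
  rw [List.length_ofFn]

/-- The lengths of all gaps, in nonincreasing order. -/
theorem exists_gapString (hD : 0 < D ∧ D < 1) :
    ∃ (ℓ : ℕ → ℝ) (E : ℕ ≃ GapIndex), (∀ j, ℓ j = gapLength D (E j)) ∧
      IsBoundedFractalString ℓ := by
  have hsum : Summable fun q => gapLength D q := by
    simpa using summable_gapLength_rpow hD hD.2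
  have : Infinite GapIndex :=
    Infinite.of_injective (fun k : ℕ => (⟨k, [], ⟨0, by omega⟩⟩ : GapIndex)) fun a b h =>
      congrArg Sigma.fst h
  obtain ⟨E, hE⟩ := exists_equiv_nat_antitone (gapLength_pos hD) hsum
  exact ⟨fun j => gapLength D (E j), E, fun _ => rfl, fun _ => gapLength_pos hD _, hE,
    E.summable_iff.2 hsum⟩

/-- The family of all gap lengths is the disjoint union of the fractal strings of the scaled
Cantor sets. -/
theorem exists_isDisjointUnion (hD : 0 < D ∧ D < 1) {ℓ : ℕ → ℝ} (E : ℕ ≃ GapIndex)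
    (hE : ∀ j, ℓ j = gapLength D (E j)) :
    ∃ L : ℕ → ℕ → ℝ,
      (∀ k : ℕ, IsFractalStringOf (L k)
        (scaledCantorSet ((1 / 2 : ℝ) ^ (k + 1)) (k + 2) (((k + 2 : ℕ) : ℝ) ^ (-(1 / D))))) ∧
      IsDisjointUnion ℓ L := by
  have hsort : ∀ k : ℕ, ∃ e : ℕ ≃ List (Fin (k + 2)) × Fin (k + 2 - 1),
      IsBoundedFractalString fun n => gapLength D ⟨k, e n⟩ := by
    intro k
    have hsum : Summable fun x : List (Fin (k + 2)) × Fin (k + 2 - 1) => gapLength D ⟨k, x⟩ := by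
      simpa using (hasSum_gapLength_rpow hD k hD.2).summable
    have : Nonempty (Fin (k + 2 - 1)) := ⟨⟨0, by omega⟩⟩
    obtain ⟨e, he⟩ := exists_equiv_nat_antitone (fun x => gapLength_pos hD ⟨k, x⟩) hsum
    exact ⟨e, fun _ => gapLength_pos hD _, he, e.summable_iff.2 hsum⟩
  choose e he using hsort
  refine ⟨fun k n => gapLength D ⟨k, e k n⟩, fun k => ⟨he k, ?_⟩, ?_⟩
  · obtain ⟨g, hg⟩ := exists_equiv_gaps_scaledCantorSet (m := k + 2) (a := ratio D k) (by omega)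
      (ratio_pos D k) (mul_ratio_lt_one hD k) (c := (1 / 2 : ℝ) ^ (k + 1)) (by positivity)
    exact ⟨(e k).trans g, fun j => (hg (e k j)).symm⟩
  · refine ⟨E.trans ((Equiv.sigmaCongrRight fun k => (e k).symm).trans
      (Equiv.sigmaEquivProd ℕ ℕ)), fun j => ?_⟩
    rw [hE]
    change gapLength D (E j) = gapLength D ⟨(E j).1, e (E j).1 ((e (E j).1).symm (E j).2)⟩
    rw [Equiv.apply_symm_apply]

end GapFamily

/-! ### The distribution of the distance function -/

theorem infDist_eq_min_of_gap {A : Set ℝ} {u v x : ℝ} (hu : u ∈ A) (hv : v ∈ A)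
    (hd : Disjoint (Ioo u v) A) (hx : x ∈ Ioo u v) :
    Metric.infDist x A = min (x - u) (v - x) := by
  apply le_antisymm
  · refine le_min ?_ ?_
    · have := Metric.infDist_le_dist_of_mem (x := x) hu
      rwa [Real.dist_eq, abs_of_pos (sub_pos.2 hx.1)] at this
    · have := Metric.infDist_le_dist_of_mem (x := x) hv
      rwa [Real.dist_eq, abs_sub_comm, abs_of_pos (sub_pos.2 hx.2)] at this
  · refine (Metric.le_infDist ⟨u, hu⟩).2 fun y hy => ?_
    rw [Real.dist_eq]
    rcases le_or_gt y u with h | h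
    · exact (min_le_left _ _).trans ((by linarith : x - u ≤ x - y).trans (le_abs_self _))
    · have hvy : v ≤ y := by
        by_contra! h'
        exact Set.disjoint_left.1 hd ⟨h, h'⟩ hy
      exact (min_le_right _ _).trans
        ((by linarith : v - x ≤ -(x - y)).trans (neg_le_abs _))

theorem map_sub_right_restrict (c : ℝ) {S T : Set ℝ} (h : (fun x => x - c) ⁻¹' T = S)
    (hT : MeasurableSet T) :
    (volume.restrict S).map (fun x : ℝ => x - c) = volume.restrict T := by
  rw [← h, ← Measure.restrict_map (by fun_prop) hT, map_sub_right_eq_self]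

theorem map_sub_left_restrict (c : ℝ) {S T : Set ℝ} (h : (fun x => c - x) ⁻¹' T = S)
    (hT : MeasurableSet T) :
    (volume.restrict S).map (fun x : ℝ => c - x) = volume.restrict T := by
  rw [← h, ← Measure.restrict_map (by fun_prop) hT, Measure.map_sub_left_eq_self]

/-- On a gap of length `b`, the distance to the set is distributed as twice Lebesgue measure
on `(0, b / 2)`. -/
theorem map_infDist_gap {A : Set ℝ} {u v : ℝ} (hu : u ∈ A) (hv : v ∈ A) (huv : u < v)
    (hd : Disjoint (Ioo u v) A) :
    (volume.restrict (Ioo u v)).map (fun x => Metric.infDist x A) =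
      (2 : ENNReal) • volume.restrict (Ioo 0 ((v - u) / 2)) := by
  have hmeas : Measurable fun x : ℝ => Metric.infDist x A := by fun_prop
  set w := (u + v) / 2 with hw
  have e : Ioo u v = Ioo u w ∪ Ico w v := by
    rw [Ioo_union_Ico_eq_Ioo] <;> linarith
  have hdisj : Disjoint (Ioo u w) (Ico w v) :=
    Set.disjoint_left.2 fun x hx hx' => absurd hx.2 (not_lt.2 hx'.1)
  have h1 : (volume.restrict (Ioo u w)).map (fun x => Metric.infDist x A) =
      volume.restrict (Ioo 0 ((v - u) / 2)) := by
    rw [← map_sub_right_restrict u (S := Ioo u w) (T := Ioo 0 ((v - u) / 2)) ?_ measurableSet_Ioo]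
    · refine Measure.map_congr ?_
      filter_upwards [ae_restrict_mem measurableSet_Ioo] with x hx
      rw [infDist_eq_min_of_gap hu hv hd ⟨hx.1, by linarith [hx.2]⟩, min_eq_left]
      linarith [hx.2]
    · ext x
      simp only [mem_preimage, mem_Ioo]
      constructor <;> rintro ⟨_, _⟩ <;> constructor <;> linarith
  have h2 : (volume.restrict (Ico w v)).map (fun x => Metric.infDist x A) =
      volume.restrict (Ioo 0 ((v - u) / 2)) := by
    rw [Measure.restrict_congr_set (Ioo_ae_eq_Ioc (a := (0 : ℝ)) (b := (v - u) / 2)),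
      ← map_sub_left_restrict v (S := Ico w v) (T := Ioc 0 ((v - u) / 2)) ?_ measurableSet_Ioc]
    · refine Measure.map_congr ?_
      filter_upwards [ae_restrict_mem measurableSet_Ico] with x hx
      rw [infDist_eq_min_of_gap hu hv hd ⟨by linarith [hx.1], hx.2⟩, min_eq_right]
      linarith [hx.1]
    · ext x
      simp only [mem_preimage, mem_Ioc, mem_Ico]
      constructor <;> rintro ⟨_, _⟩ <;> constructor <;> linarith
  rw [e, Measure.restrict_union hdisj measurableSet_Ico, Measure.map_add _ _ hmeas, h1, h2,
    two_smul]

section StringPoints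

variable {ℓ : ℕ → ℝ}

theorem stringPoint_succ_add (hℓ : IsBoundedFractalString ℓ) (k : ℕ) :
    stringPoint ℓ k = ℓ k + stringPoint ℓ (k + 1) := by
  have hs : Summable fun j => ℓ (k + j) := by
    simpa [add_comm] using (summable_nat_add_iff k).2 hℓ.summable
  rw [stringPoint, hs.tsum_eq_zero_add, stringPoint]
  simp only [add_zero]
  congr 2
  funext j
  congr 1
  ring

theorem stringPoint_pos (hℓ : IsBoundedFractalString ℓ) (k : ℕ) : 0 < stringPoint ℓ k := by
  have h : 0 ≤ stringPoint ℓ (k + 1) := tsum_nonneg fun j => (hℓ.pos _).le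
  rw [stringPoint_succ_add hℓ]
  linarith [hℓ.pos k]

theorem stringPoint_strictAnti (hℓ : IsBoundedFractalString ℓ) : StrictAnti (stringPoint ℓ) :=
  strictAnti_nat_of_succ_lt fun k => by
    rw [stringPoint_succ_add hℓ k]
    linarith [hℓ.pos k]

theorem tendsto_stringPoint (ℓ : ℕ → ℝ) : Tendsto (stringPoint ℓ) atTop (𝓝 0) := by
  have := tendsto_sum_nat_add ℓ
  simp only [add_comm _ _] at this
  exact this

theorem zero_mem_closure_stringSet (ℓ : ℕ → ℝ) : (0 : ℝ) ∈ closure (stringSet ℓ) :=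
  mem_closure_of_tendsto (tendsto_stringPoint ℓ) (Eventually.of_forall fun k => mem_range_self k)

theorem disjoint_gap_stringSet (hℓ : IsBoundedFractalString ℓ) (k : ℕ) :
    Disjoint (Ioo (stringPoint ℓ (k + 1)) (stringPoint ℓ k)) (stringSet ℓ) := by
  rw [Set.disjoint_left]
  rintro _ ⟨h1, h2⟩ ⟨j, rfl⟩
  have h1' := (stringPoint_strictAnti hℓ).lt_iff_gt.1 h1
  have h2' := (stringPoint_strictAnti hℓ).lt_iff_gt.1 h2
  omega

theorem pairwise_disjoint_string_gaps (hℓ : IsBoundedFractalString ℓ) :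
    Pairwise (Function.onFun Disjoint fun k => Ioo (stringPoint ℓ (k + 1)) (stringPoint ℓ k)) := by
  have key : ∀ i j, i < j → Disjoint (Ioo (stringPoint ℓ (i + 1)) (stringPoint ℓ i))
      (Ioo (stringPoint ℓ (j + 1)) (stringPoint ℓ j)) := by
    intro i j hij
    refine Set.disjoint_left.2 fun x hx hx' => ?_
    have := (stringPoint_strictAnti hℓ).antitone (Nat.succ_le_of_lt hij)
    exact absurd (hx.1.trans hx'.2) (not_lt.2 this)
  intro i j hij
  rcases lt_or_gt_of_ne hij with h | h
  · exact key i j h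
  · exact (key j i h).symm

theorem isBounded_stringSet (hℓ : IsBoundedFractalString ℓ) :
    Bornology.IsBounded (stringSet ℓ) := by
  refine (Metric.isBounded_Icc 0 (stringPoint ℓ 0)).subset ?_
  rintro _ ⟨k, rfl⟩
  exact ⟨(stringPoint_pos hℓ k).le, (stringPoint_strictAnti hℓ).antitone (Nat.zero_le k)⟩

theorem volume_eq_add_sum_gaps (hℓ : IsBoundedFractalString ℓ) :
    (volume : Measure ℝ) = volume.restrict (Iio 0) + volume.restrict (Ioi (stringPoint ℓ 0)) +
      Measure.sum fun k => volume.restrict (Ioo (stringPoint ℓ (k + 1)) (stringPoint ℓ k)) := by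
  rw [← Measure.restrict_iUnion (pairwise_disjoint_string_gaps hℓ) fun _ => measurableSet_Ioo,
    ← Measure.restrict_union ?_ measurableSet_Ioi, ← Measure.restrict_union ?_
      (MeasurableSet.iUnion fun _ => measurableSet_Ioo)]
  · symm
    refine Measure.restrict_eq_self_of_ae_mem ?_
    have hc : (insert 0 (range (stringPoint ℓ))).Countable := (countable_range _).insert 0
    filter_upwards [hc.ae_notMem volume] with x hx
    simp only [mem_insert_iff, mem_range, not_or, not_exists] at hx
    rcases lt_or_gt_of_ne hx.1 with h | h
    · exact Or.inl (Or.inl h)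
    rcases lt_or_ge (stringPoint ℓ 0) x with h0 | h0
    · exact Or.inl (Or.inr h0)
    right
    have hex : ∃ k, stringPoint ℓ k < x :=
      ((tendsto_stringPoint ℓ).eventually (gt_mem_nhds h)).exists
    classical
    obtain ⟨k, hk⟩ : ∃ k, Nat.find hex = k + 1 := by
      refine Nat.exists_eq_succ_of_ne_zero fun h' => ?_
      have := Nat.find_spec hex
      rw [h'] at this
      linarith
    have h1 := Nat.find_spec hex
    rw [hk] at h1
    have h2 := not_lt.1 (Nat.find_min hex (m := k) (by omega))
    exact mem_iUnion.2 ⟨k, h1, lt_of_le_of_ne h2 (Ne.symm (hx.2 k))⟩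
  · refine Set.disjoint_left.2 fun x hx hx' => ?_
    obtain ⟨k, hk⟩ := mem_iUnion.1 hx'
    rcases hx with hx | hx
    · linarith [hk.1, stringPoint_pos hℓ (k + 1), mem_Iio.1 hx]
    · have := (stringPoint_strictAnti hℓ).antitone (Nat.zero_le k)
      linarith [hk.2, mem_Ioi.1 hx]
  · refine Set.disjoint_left.2 fun x hx hx' => ?_
    linarith [mem_Iio.1 hx, mem_Ioi.1 hx', stringPoint_pos hℓ 0]

/-- The sum over `j` of twice Lebesgue measure on `(0, min (ℓ_j / 2) δ)`. It is the distribution of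
the distance to the boundary on the part of the gaps within distance `δ` of it. -/
def innerTubeMeasure (ℓ : ℕ → ℝ) (δ : ℝ) : Measure ℝ :=
  Measure.sum fun j => (2 : ENNReal) • volume.restrict (Ioo 0 (min (ℓ j / 2) δ))

theorem sum_restrict_Iio_eq (ℓ : ℕ → ℝ) (δ : ℝ) :
    (Measure.sum fun j => (2 : ENNReal) • (volume : Measure ℝ).restrict (Ioo 0 (ℓ j / 2))).restrict
      (Iio δ) = innerTubeMeasure ℓ δ := by
  rw [Measure.restrict_sum _ measurableSet_Iio, innerTubeMeasure]
  congr 1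
  funext j
  rw [Measure.restrict_smul, Measure.restrict_restrict measurableSet_Iio, Set.inter_comm,
    Ioo_inter_Iio]

/-- The distribution of the distance to `A_ℓ` on the `δ`-neighborhood of `A_ℓ`. -/
theorem map_infDist_thickening (hℓ : IsBoundedFractalString ℓ) (δ : ℝ) :
    (volume.restrict (Metric.thickening δ (stringSet ℓ))).map
        (fun x => Metric.infDist x (stringSet ℓ)) =
      (2 : ENNReal) • volume.restrict (Ioo 0 δ) + innerTubeMeasure ℓ δ := by
  have hmeas : Measurable fun x : ℝ => Metric.infDist x (stringSet ℓ) := by fun_prop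
  have hne : (stringSet ℓ).Nonempty := range_nonempty _
  have hth : Metric.thickening δ (stringSet ℓ) =
      (fun x => Metric.infDist x (stringSet ℓ)) ⁻¹' (Iio δ) := by
    ext x
    exact Metric.mem_thickening_iff_infDist_lt hne
  have hleft : (volume.restrict (Iio (0 : ℝ))).map (fun x => Metric.infDist x (stringSet ℓ)) =
      volume.restrict (Ioi 0) := by
    rw [← map_sub_left_restrict 0 (S := Iio 0) (T := Ioi 0) (by ext x; simp) measurableSet_Ioi]
    refine Measure.map_congr ?_
    filter_upwards [ae_restrict_mem measurableSet_Iio] with x hx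
    have hx0 : x < 0 := hx
    apply le_antisymm
    · have := Metric.infDist_le_dist_of_mem (x := x) (zero_mem_closure_stringSet ℓ)
      rw [Metric.infDist_closure, Real.dist_eq, sub_zero, abs_of_neg hx0] at this
      linarith
    · refine (Metric.le_infDist hne).2 ?_
      rintro _ ⟨k, rfl⟩
      rw [Real.dist_eq]
      linarith [neg_le_abs (x - stringPoint ℓ k), stringPoint_pos hℓ k]
  have hright : (volume.restrict (Ioi (stringPoint ℓ 0))).map
      (fun x => Metric.infDist x (stringSet ℓ)) = volume.restrict (Ioi 0) := by
    rw [← map_sub_right_restrict (stringPoint ℓ 0) (S := Ioi (stringPoint ℓ 0)) (T := Ioi 0)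
      (by ext x; simp) measurableSet_Ioi]
    refine Measure.map_congr ?_
    filter_upwards [ae_restrict_mem measurableSet_Ioi] with x hx
    have hx0 : stringPoint ℓ 0 < x := hx
    apply le_antisymm
    · have := Metric.infDist_le_dist_of_mem (x := x) (mem_range_self (f := stringPoint ℓ) 0)
      rwa [Real.dist_eq, abs_of_pos (sub_pos.2 hx0)] at this
    · refine (Metric.le_infDist hne).2 ?_
      rintro _ ⟨k, rfl⟩
      rw [Real.dist_eq]
      linarith [le_abs_self (x - stringPoint ℓ k),
        (stringPoint_strictAnti hℓ).antitone (Nat.zero_le k)]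
  have hgap : ∀ k, (volume.restrict (Ioo (stringPoint ℓ (k + 1)) (stringPoint ℓ k))).map
      (fun x => Metric.infDist x (stringSet ℓ)) =
      (2 : ENNReal) • volume.restrict (Ioo 0 (ℓ k / 2)) := by
    intro k
    rw [map_infDist_gap (A := stringSet ℓ) (mem_range_self _) (mem_range_self _)
      (stringPoint_strictAnti hℓ (Nat.lt_succ_self k)) (disjoint_gap_stringSet hℓ k),
      stringPoint_succ_add hℓ k]
    simp
  have hmap := congrArg (Measure.map fun x => Metric.infDist x (stringSet ℓ))
    (volume_eq_add_sum_gaps hℓ)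
  rw [Measure.map_add _ _ hmeas, Measure.map_add _ _ hmeas, Measure.map_sum hmeas.aemeasurable,
    hleft, hright] at hmap
  simp only [hgap] at hmap
  rw [hth, ← Measure.restrict_map hmeas measurableSet_Iio, hmap, Measure.restrict_add,
    ← two_smul ENNReal, Measure.restrict_smul, Measure.restrict_restrict measurableSet_Iio,
    sum_restrict_Iio_eq, Set.inter_comm, Ioi_inter_Iio]

/-- The inner `t`-neighborhood of the boundary of the geometric realization. -/
theorem volume_inner_tube (hℓ : IsBoundedFractalString ℓ) (t : ℝ) :
    volume {x ∈ stringDomain ℓ | Metric.infDist x (frontier (stringDomain ℓ)) < t} =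
      innerTubeMeasure ℓ t univ := by
  set F := frontier (stringDomain ℓ) with hF
  have hmeas : Measurable fun x : ℝ => Metric.infDist x F := by fun_prop
  have hopen : IsOpen (stringDomain ℓ) := isOpen_iUnion fun _ => isOpen_Ioo
  have hmem : ∀ k, stringPoint ℓ k ∈ F := by
    intro k
    rw [hF, hopen.frontier_eq]
    constructor
    · have h1 : stringPoint ℓ k ∈ closure (Ioo (stringPoint ℓ (k + 1)) (stringPoint ℓ k)) := by
        have h := stringPoint_strictAnti hℓ (Nat.lt_succ_self k)
        rw [closure_Ioo h.ne]
        exact right_mem_Icc.2 h.le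
      exact closure_mono (subset_iUnion
        (fun k => Ioo (stringPoint ℓ (k + 1)) (stringPoint ℓ k)) k) h1
    · intro h
      obtain ⟨j, hj⟩ := mem_iUnion.1 h
      exact Set.disjoint_left.1 (disjoint_gap_stringSet hℓ j) hj (mem_range_self k)
  have hgap : ∀ k, (volume.restrict (Ioo (stringPoint ℓ (k + 1)) (stringPoint ℓ k))).map
      (fun x => Metric.infDist x F) = (2 : ENNReal) • volume.restrict (Ioo 0 (ℓ k / 2)) := by
    intro k
    rw [map_infDist_gap (hmem _) (hmem _) (stringPoint_strictAnti hℓ (Nat.lt_succ_self k)),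
      stringPoint_succ_add hℓ k]
    · simp
    · rw [hF, hopen.frontier_eq]
      exact Set.disjoint_left.2 fun x hx hx' => hx'.2 (mem_iUnion.2 ⟨k, hx⟩)
  have hset : {x ∈ stringDomain ℓ | Metric.infDist x F < t} =
      (fun x => Metric.infDist x F) ⁻¹' (Iio t) ∩ stringDomain ℓ := by
    ext x
    exact and_comm
  rw [hset, ← Measure.restrict_apply (hmeas measurableSet_Iio),
    ← Measure.map_apply hmeas measurableSet_Iio, stringDomain,
    Measure.restrict_iUnion (pairwise_disjoint_string_gaps hℓ) fun _ => measurableSet_Ioo,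
    Measure.map_sum hmeas.aemeasurable]
  simp only [hgap]
  rw [← sum_restrict_Iio_eq, Measure.restrict_apply_univ]

theorem innerTubeMeasure_univ (ℓ : ℕ → ℝ) (t : ℝ) :
    innerTubeMeasure ℓ t univ = ∑' j, 2 * ENNReal.ofReal (min (ℓ j / 2) t) := by
  simp [innerTubeMeasure, Measure.sum_apply]

theorem volume_outer_tube (hℓ : IsBoundedFractalString ℓ) (t : ℝ) :
    volume (Metric.thickening t (stringSet ℓ)) =
      2 * ENNReal.ofReal t + innerTubeMeasure ℓ t univ := by
  have h := congrArg (fun μ : Measure ℝ => μ univ) (map_infDist_thickening hℓ t)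
  rw [Measure.map_apply (by fun_prop) MeasurableSet.univ] at h
  simpa using h

end StringPoints

/-! ### Abscissa and dimensions -/

theorem csInf_eq_of_Ioo_subset {S : Set ℝ} {D : ℝ} (hD : D < 1) (h1 : ∀ r ∈ S, D ≤ r)
    (h2 : ∀ r, D < r → r < 1 → r ∈ S) : sInf S = D := by
  refine csInf_eq_of_forall_ge_of_forall_gt_exists_lt ?_ h1 fun w hw => ?_
  · exact ⟨(D + 1) / 2, h2 _ (by linarith) (by linarith)⟩
  · obtain ⟨r, hr1, hr2⟩ := exists_between (lt_min hw hD)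
    exact ⟨r, h2 r hr1 (hr2.trans_le (min_le_right _ _)), hr2.trans_le (min_le_left _ _)⟩

/-- The string `ℓ` has, at every level `n`, at least `2 ^ n` lengths equal to `b ρ ^ n`, where
`ρ = 2 ^ (-1/D)`; this makes `D` a lower bound for its abscissa and its dimensions. -/
def HasCantorLevels (ℓ : ℕ → ℝ) (D b : ℝ) : Prop :=
  ∀ n : ℕ, ∃ S : Finset ℕ, S.card = 2 ^ n ∧ ∀ j ∈ S, ℓ j = b * ratio D 0 ^ n

section Dimensions

variable {ℓ : ℕ → ℝ} {D b : ℝ}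

theorem ratio_zero_rpow_pow (D α : ℝ) (n : ℕ) :
    (2 : ℝ) ^ n * (ratio D 0 ^ n) ^ α = ((2 : ℝ) ^ (1 - α / D)) ^ n := by
  have h := ratio_rpow D 0 α
  simp only [Nat.cast_zero, zero_add] at h
  rw [← h, mul_pow, ← Real.rpow_natCast (ratio D 0), ← Real.rpow_mul (ratio_pos D 0).le,
    mul_comm _ α, Real.rpow_mul (ratio_pos D 0).le, Real.rpow_natCast]

theorem not_summable_rpow (hD : 0 < D) (hpos : ∀ j, 0 < ℓ j) (hb : 0 < b)
    (hlev : HasCantorLevels ℓ D b) {α : ℝ} (hα : α < D) : ¬ Summable fun j => ℓ j ^ α := by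
  intro hs
  have hbd : ∀ n : ℕ, b ^ α * ((2 : ℝ) ^ (1 - α / D)) ^ n ≤ ∑' j, ℓ j ^ α := by
    intro n
    obtain ⟨S, hS, hS'⟩ := hlev n
    refine le_trans (le_of_eq ?_)
      (hs.sum_le_tsum S fun j _ => Real.rpow_nonneg (hpos j).le _)
    rw [Finset.sum_congr rfl fun j hj => by rw [hS' j hj], Finset.sum_const, hS,
      Real.mul_rpow hb.le (pow_pos (ratio_pos D 0) n).le, ← ratio_zero_rpow_pow]
    push_cast [nsmul_eq_mul]
    ring
  have h1 : 1 < (2 : ℝ) ^ (1 - α / D) := by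
    refine Real.one_lt_rpow (by norm_num) ?_
    have := (div_lt_one hD).2 hα
    linarith
  have h2 := (tendsto_pow_atTop_atTop_of_one_lt h1).const_mul_atTop (Real.rpow_pos_of_pos hb α)
  obtain ⟨n, hn⟩ := (h2.eventually_gt_atTop (∑' j, ℓ j ^ α)).exists
  exact absurd (hbd n) (not_le.2 hn)

theorem geometricAbscissa_eq (hD : 0 < D ∧ D < 1) (hpos : ∀ j, 0 < ℓ j) (hb : 0 < b)
    (hlev : HasCantorLevels ℓ D b) (hsum : ∀ α, D < α → Summable fun j => ℓ j ^ α) :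
    geometricAbscissa ℓ = D :=
  csInf_eq_of_Ioo_subset hD.2
    (fun _ hr => not_lt.1 fun h => not_summable_rpow hD.1 hpos hb hlev h hr)
    fun r hr _ => hsum r hr

/-- A tube function that differs from the inner tube function of `ℓ` by at most `2 t` has critical
exponent `D`. -/
theorem upperExponent_eq (hD : 0 < D ∧ D < 1) (hpos : ∀ j, 0 < ℓ j) (hb : 0 < b)
    (hlev : HasCantorLevels ℓ D b) (hsum : ∀ α, D < α → Summable fun j => ℓ j ^ α)
    {V : ℝ → ENNReal} (hV1 : ∀ t, innerTubeMeasure ℓ t univ ≤ V t)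
    (hV2 : ∀ t, V t ≤ 2 * ENNReal.ofReal t + innerTubeMeasure ℓ t univ) :
    upperExponent V = D := by
  refine csInf_eq_of_Ioo_subset hD.2 ?_ ?_
  · rintro r ⟨hr0, hr⟩
    by_contra! hrD
    -- At `t = b ρ ^ n / 2` the lengths of level `n` alone keep the content away from zero.
    set t : ℕ → ℝ := fun n => b / 2 * ratio D 0 ^ n with ht
    have hρ := ratio_pos D 0
    have hρ1 : ratio D 0 < 1 := by
      have := mul_ratio_lt_one hD 0
      norm_num at this
      linarith
    have htpos : ∀ n, 0 < t n := fun n => by positivity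
    have htlim : Tendsto t atTop (𝓝[>] 0) := by
      refine tendsto_nhdsWithin_iff.2 ⟨?_, Eventually.of_forall htpos⟩
      simpa using (tendsto_pow_atTop_nhds_zero_of_lt_one hρ.le hρ1).const_mul (b / 2)
    have hc : 0 < (b / 2) ^ r := Real.rpow_pos_of_pos (by positivity) r
    have hlow : ∀ n, ENNReal.ofReal ((b / 2) ^ r) ≤ V (t n) / ENNReal.ofReal (t n ^ (1 - r)) := by
      intro n
      have htr := Real.rpow_pos_of_pos (htpos n) (1 - r)
      rw [ENNReal.le_div_iff_mul_le (Or.inl (ENNReal.ofReal_pos.2 htr).ne')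
        (Or.inl ENNReal.ofReal_ne_top), ← ENNReal.ofReal_mul hc.le]
      refine le_trans ?_ (hV1 (t n))
      obtain ⟨S, hS, hS'⟩ := hlev n
      rw [innerTubeMeasure_univ]
      refine le_trans ?_ (ENNReal.sum_le_tsum S)
      have e : ∀ j ∈ S, 2 * ENNReal.ofReal (min (ℓ j / 2) (t n)) = 2 * ENNReal.ofReal (t n) := by
        intro j hj
        rw [hS' j hj, ht, min_eq_right (by ring_nf; rfl)]
      rw [Finset.sum_congr rfl e, Finset.sum_const, hS, nsmul_eq_mul]
      have e2 : ENNReal.ofReal ((2 : ℝ) ^ n * t n) = (2 ^ n : ℕ) * ENNReal.ofReal (t n) := by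
        rw [ENNReal.ofReal_mul (by positivity)]
        congr 1
        rw [← ENNReal.ofReal_natCast]
        push_cast
        rfl
      calc ENNReal.ofReal ((b / 2) ^ r * t n ^ (1 - r))
          ≤ ENNReal.ofReal ((2 : ℝ) ^ n * t n) := by
            refine ENNReal.ofReal_le_ofReal ?_
            have e3 : t n = t n ^ r * t n ^ (1 - r) := by
              rw [← Real.rpow_add (htpos n)]; simp
            have e4 : t n ^ r = (b / 2) ^ r * (ratio D 0 ^ n) ^ r :=
              Real.mul_rpow (by positivity) (by positivity)
            have e5 : 1 ≤ (2 : ℝ) ^ n * (ratio D 0 ^ n) ^ r := by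
              rw [ratio_zero_rpow_pow]
              refine one_le_pow₀ (Real.one_le_rpow (by norm_num) ?_)
              have := (div_lt_one hD.1).2 hrD
              linarith
            calc (b / 2) ^ r * t n ^ (1 - r)
                ≤ ((2 : ℝ) ^ n * (ratio D 0 ^ n) ^ r) * ((b / 2) ^ r * t n ^ (1 - r)) :=
                  le_mul_of_one_le_left (by positivity) e5
              _ = (2 : ℝ) ^ n * (t n ^ r * t n ^ (1 - r)) := by rw [e4]; ring
              _ = (2 : ℝ) ^ n * t n := by rw [← e3]
        _ = (2 ^ n : ℕ) * ENNReal.ofReal (t n) := e2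
        _ ≤ (2 ^ n : ℕ) * (2 * ENNReal.ofReal (t n)) := by
            gcongr
            exact le_mul_of_one_le_left (by positivity) (by norm_num)
    have h0 : upperContent V r < ENNReal.ofReal ((b / 2) ^ r) := by
      rw [hr]; exact ENNReal.ofReal_pos.2 hc
    obtain ⟨n, hn⟩ := (htlim.eventually (eventually_lt_of_limsup_lt h0)).exists
    exact absurd (hlow n) (not_le.2 hn)
  · intro r hDr hr1
    refine ⟨hD.1.trans hDr, ?_⟩
    -- Interpolation: `min x t ≤ x ^ r' * t ^ (1 - r')` for an exponent `r'` between `D` and `r`.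
    obtain ⟨r', hr'D, hr'r⟩ := exists_between hDr
    have hr'0 := hD.1.trans hr'D
    set C := ∑' j, ℓ j ^ r' with hC
    have hbound : ∀ t, 0 < t →
        V t / ENNReal.ofReal (t ^ (1 - r)) ≤ ENNReal.ofReal (2 * t ^ r + 2 * C * t ^ (r - r')) := by
      intro t ht
      have hterm : ∀ j, 2 * ENNReal.ofReal (min (ℓ j / 2) t) ≤
          ENNReal.ofReal (2 * t ^ (1 - r') * ℓ j ^ r') := by
        intro j
        have hm : 0 < min (ℓ j / 2) t := lt_min (by linarith [hpos j]) ht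
        rw [show (2 : ENNReal) = ENNReal.ofReal 2 by simp, ← ENNReal.ofReal_mul zero_le_two]
        refine ENNReal.ofReal_le_ofReal ?_
        calc 2 * min (ℓ j / 2) t
            = 2 * (min (ℓ j / 2) t ^ (1 - r') * min (ℓ j / 2) t ^ r') := by
              rw [← Real.rpow_add hm]; simp
          _ ≤ 2 * (t ^ (1 - r') * ℓ j ^ r') := by
              gcongr
              · linarith
              · exact min_le_right _ _
              · exact (min_le_left _ _).trans (by linarith [hpos j])
          _ = _ := by ring
      have hsum' := (hsum r' hr'D).mul_left (2 * t ^ (1 - r'))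
      have hV : V t ≤ ENNReal.ofReal (2 * t + 2 * t ^ (1 - r') * C) := by
        refine (hV2 t).trans ?_
        have hC0 : 0 ≤ C := tsum_nonneg fun j => Real.rpow_nonneg (hpos j).le _
        rw [ENNReal.ofReal_add (by positivity) (by positivity), innerTubeMeasure_univ,
          ENNReal.ofReal_mul zero_le_two, ENNReal.ofReal_ofNat, hC, ← tsum_mul_left]
        gcongr
        refine (ENNReal.tsum_le_tsum hterm).trans_eq ?_
        rw [ENNReal.ofReal_tsum_of_nonneg _ hsum']
        intro j
        have := Real.rpow_nonneg (hpos j).le r'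
        positivity
      have htr := Real.rpow_pos_of_pos ht (1 - r)
      refine (ENNReal.div_le_div_right hV _).trans_eq ?_
      rw [← ENNReal.ofReal_div_of_pos htr]
      congr 1
      have e1 : t = t ^ r * t ^ (1 - r) := by rw [← Real.rpow_add ht]; simp
      have e2 : t ^ (1 - r') = t ^ (r - r') * t ^ (1 - r) := by
        rw [← Real.rpow_add ht]; congr 1; ring
      rw [div_eq_iff htr.ne', e2]
      nth_rewrite 1 [e1]
      ring
    have hlim : Tendsto (fun t : ℝ => ENNReal.ofReal (2 * t ^ r + 2 * C * t ^ (r - r')))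
        (𝓝[>] 0) (𝓝 0) := by
      have h : ∀ x : ℝ, 0 < x → Tendsto (fun t : ℝ => t ^ x) (𝓝[>] 0) (𝓝 0) := by
        intro x hx
        have := (Real.continuousAt_rpow_const 0 x (Or.inr hx.le)).tendsto
        rw [Real.zero_rpow hx.ne'] at this
        exact this.mono_left nhdsWithin_le_nhds
      have h2 := ((h r (hD.1.trans hDr)).const_mul 2).add
        ((h (r - r') (by linarith)).const_mul (2 * C))
      have h3 := ENNReal.tendsto_ofReal h2
      simpa using h3
    have hlim' : Tendsto (fun t : ℝ => V t / ENNReal.ofReal (t ^ (1 - r))) (𝓝[>] 0) (𝓝 0) := by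
      refine tendsto_of_tendsto_of_tendsto_of_le_of_le' tendsto_const_nhds hlim
        (Eventually.of_forall fun _ => zero_le) ?_
      filter_upwards [self_mem_nhdsWithin] with t ht
      exact hbound t ht
    exact hlim'.limsup_eq

/-! ### The distance zeta function -/

theorem min_half_pos (hpos : ∀ j, 0 < ℓ j) {δ : ℝ} (hδ : 0 < δ) (j : ℕ) :
    0 < min (ℓ j / 2) δ :=
  lt_min (by linarith [hpos j]) hδ

theorem eventually_half_le (hℓ : IsBoundedFractalString ℓ) {δ : ℝ} (hδ : 0 < δ) :
    ∀ᶠ j in cofinite, ℓ j / 2 ≤ δ := by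
  filter_upwards [hℓ.summable.tendsto_cofinite_zero.eventually
    (gt_mem_nhds (by linarith : 0 < 2 * δ))] with j hj
  linarith

theorem lintegral_tubeMeasure (f : ℝ → ENNReal) (ℓ : ℕ → ℝ) (δ : ℝ) :
    ∫⁻ t, f t ∂((2 : ENNReal) • volume.restrict (Ioo 0 δ) + innerTubeMeasure ℓ δ) =
      2 * (∫⁻ t in Ioo 0 δ, f t) + ∑' j, 2 * ∫⁻ t in Ioo 0 (min (ℓ j / 2) δ), f t := by
  simp [innerTubeMeasure, lintegral_add_measure, lintegral_sum_measure, lintegral_smul_measure]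

theorem lintegral_infEDist_thickening (hℓ : IsBoundedFractalString ℓ) (δ α : ℝ) :
    ∫⁻ x in Metric.thickening δ (stringSet ℓ), Metric.infEDist x (stringSet ℓ) ^ (α - 1) =
      2 * (∫⁻ t in Ioo 0 δ, ENNReal.ofReal t ^ (α - 1)) +
        ∑' j, 2 * ∫⁻ t in Ioo 0 (min (ℓ j / 2) δ), ENNReal.ofReal t ^ (α - 1) := by
  rw [← lintegral_tubeMeasure, ← map_infDist_thickening hℓ,
    lintegral_map (by fun_prop) (by fun_prop)]
  refine lintegral_congr fun x => ?_
  rw [Metric.infDist, ENNReal.ofReal_toReal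
    (Metric.infEDist_ne_top (show (stringSet ℓ).Nonempty from range_nonempty _))]

theorem lintegral_Ioo_rpow {α r : ℝ} (hα : 0 < α) (hr : 0 < r) :
    ∫⁻ t in Ioo 0 r, ENNReal.ofReal t ^ (α - 1) = ENNReal.ofReal (r ^ α / α) := by
  have h1 : IntervalIntegrable (fun t : ℝ => t ^ (α - 1)) volume 0 r :=
    intervalIntegral.intervalIntegrable_rpow' (by linarith)
  have h2 : ∫ t in (0 : ℝ)..r, t ^ (α - 1) = r ^ α / α := by
    rw [integral_rpow (Or.inl (by linarith))]
    simp [hα.ne']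
  rw [← h2, intervalIntegral.integral_of_le hr.le, integral_Ioc_eq_integral_Ioo,
    ofReal_integral_eq_lintegral_ofReal]
  · refine setLIntegral_congr_fun measurableSet_Ioo fun t ht => ?_
    exact ENNReal.ofReal_rpow_of_pos ht.1
  · rw [← IntegrableOn, ← integrableOn_Ioc_iff_integrableOn_Ioo]
    exact (intervalIntegrable_iff_integrableOn_Ioc_of_le hr.le).1 h1
  · filter_upwards [ae_restrict_mem measurableSet_Ioo] with t ht
    exact Real.rpow_nonneg ht.1.le _

theorem ofReal_rpow_le_lintegral_Ioo {α r : ℝ} (hα : α ≤ 1) (hr : 0 < r) :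
    ENNReal.ofReal (r ^ α) ≤ ∫⁻ t in Ioo 0 r, ENNReal.ofReal t ^ (α - 1) := by
  calc ENNReal.ofReal (r ^ α) = ∫⁻ _ in Ioo 0 r, ENNReal.ofReal (r ^ (α - 1)) := by
        rw [setLIntegral_const, Real.volume_Ioo, sub_zero,
          ← ENNReal.ofReal_mul (Real.rpow_nonneg hr.le _)]
        congr 1
        nth_rewrite 3 [← Real.rpow_one r]
        rw [← Real.rpow_add hr]
        simp
    _ ≤ _ := by
        refine setLIntegral_mono' measurableSet_Ioo fun t ht => ?_
        rw [ENNReal.ofReal_rpow_of_pos ht.1]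
        exact ENNReal.ofReal_le_ofReal
          (Real.rpow_le_rpow_of_nonpos ht.1 ht.2.le (by linarith))

theorem lintegral_infEDist_lt_top (hD : 0 < D) (hℓ : IsBoundedFractalString ℓ)
    (hsum : ∀ α, D < α → Summable fun j => ℓ j ^ α) {δ : ℝ} (hδ : 0 < δ) {α : ℝ} (hα : D < α) :
    2 * (∫⁻ t in Ioo 0 δ, ENNReal.ofReal t ^ (α - 1)) +
      ∑' j, 2 * ∫⁻ t in Ioo 0 (min (ℓ j / 2) δ), ENNReal.ofReal t ^ (α - 1) < ⊤ := by
  have hα0 := hD.trans hα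
  have hs : Summable fun j => min (ℓ j / 2) δ ^ α / α := by
    refine Summable.div_const (Summable.of_nonneg_of_le (fun j => ?_) (fun j => ?_) (hsum α hα)) α
    · exact Real.rpow_nonneg (min_half_pos hℓ.pos hδ j).le _
    · exact Real.rpow_le_rpow (min_half_pos hℓ.pos hδ j).le
        ((min_le_left _ _).trans (by linarith [hℓ.pos j])) hα0.le
  simp only [fun j => lintegral_Ioo_rpow hα0 (min_half_pos hℓ.pos hδ j),
    lintegral_Ioo_rpow hα0 hδ, ENNReal.tsum_mul_left]
  rw [← ENNReal.ofReal_tsum_of_nonneg _ hs]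
  · exact ENNReal.add_lt_top.2 ⟨ENNReal.mul_lt_top (by simp) ENNReal.ofReal_lt_top,
      ENNReal.mul_lt_top (by simp) ENNReal.ofReal_lt_top⟩
  · intro j
    have := Real.rpow_nonneg (min_half_pos hℓ.pos hδ j).le α
    positivity

theorem distanceAbscissa_eq (hD : 0 < D ∧ D < 1) (hℓ : IsBoundedFractalString ℓ) (hb : 0 < b)
    (hlev : HasCantorLevels ℓ D b) (hsum : ∀ α, D < α → Summable fun j => ℓ j ^ α)
    {δ : ℝ} (hδ : 0 < δ) : distanceAbscissa δ (stringSet ℓ) = D := by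
  refine csInf_eq_of_Ioo_subset hD.2 ?_ ?_
  · rintro α ⟨hα0, hα⟩
    by_contra! hαD
    rw [lintegral_infEDist_thickening hℓ] at hα
    have h1 := (le_add_self.trans_lt hα).ne
    have h2 : ∑' j, ENNReal.ofReal (min (ℓ j / 2) δ ^ α) ≠ ⊤ := by
      refine ne_top_of_le_ne_top h1 (ENNReal.tsum_le_tsum fun j => ?_)
      refine (ofReal_rpow_le_lintegral_Ioo (by linarith [hD.2])
        (min_half_pos hℓ.pos hδ j)).trans ?_
      exact le_mul_of_one_le_left zero_le (by norm_num)
    have h3 : Summable fun j => min (ℓ j / 2) δ ^ α := by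
      have := ENNReal.summable_toReal h2
      refine this.congr fun j => ?_
      exact ENNReal.toReal_ofReal (Real.rpow_nonneg (min_half_pos hℓ.pos hδ j).le _)
    have h4 : Summable fun j => (ℓ j / 2) ^ α := by
      refine h3.congr_cofinite ?_
      filter_upwards [eventually_half_le hℓ hδ] with j hj
      rw [min_eq_left hj]
    refine not_summable_rpow hD.1 hℓ.pos hb hlev hαD ((h4.mul_left (2 ^ α)).congr fun j => ?_)
    rw [← Real.mul_rpow zero_le_two (by linarith [hℓ.pos j])]
    congr 1
    ring
  · intro α hα _
    refine ⟨(hD.1.trans hα).le, ?_⟩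
    rw [lintegral_infEDist_thickening hℓ]
    exact lintegral_infEDist_lt_top hD.1 hℓ hsum hδ hα

theorem integral_Ioo_cpow {s : ℂ} (hs : 0 < s.re) {r : ℝ} (hr : 0 < r) :
    ∫ t in Ioo 0 r, (t : ℂ) ^ (s - 1) = (r : ℂ) ^ s / s := by
  have hs0 : s ≠ 0 := fun h => by simp [h] at hs
  rw [← integral_Ioc_eq_integral_Ioo, ← intervalIntegral.integral_of_le hr.le,
    integral_cpow (Or.inl (by simpa using hs))]
  simp [hs0]

/-- The distance zeta function of `A_ℓ` as a Dirichlet series. -/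
theorem hasSum_distanceZeta (hD : 0 < D) (hℓ : IsBoundedFractalString ℓ)
    (hsum : ∀ α, D < α → Summable fun j => ℓ j ^ α) {δ : ℝ} (hδ : 0 < δ) {s : ℂ}
    (hs : D < s.re) :
    HasSum (fun j => ((min (ℓ j / 2) δ : ℝ) : ℂ) ^ s)
      (s * distanceZeta δ (stringSet ℓ) s / 2 - (δ : ℂ) ^ s) := by
  have hs0 : 0 < s.re := hD.trans hs
  have hsne : s ≠ 0 := fun h => by simp [h] at hs0
  set f : ℝ → ℂ := fun t => (t : ℂ) ^ (s - 1) with hf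
  have hfm : Measurable f := by
    rw [hf]
    exact Complex.measurable_ofReal.pow_const _
  set μ := (2 : ENNReal) • volume.restrict (Ioo 0 δ) + innerTubeMeasure ℓ δ with hμ
  have hpos : ∀ r, ∀ᵐ t ∂((2 : ENNReal) • (volume : Measure ℝ).restrict (Ioo 0 r)), 0 < t :=
    fun r => Measure.ae_smul_measure
      ((ae_restrict_mem measurableSet_Ioo).mono fun t ht => ht.1) _
  have hμpos : ∀ᵐ t ∂μ, 0 < t := by
    rw [hμ, ae_add_measure_iff]
    exact ⟨hpos δ, Measure.ae_sum_iff.2 fun j => hpos _⟩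
  have hint : Integrable f μ := by
    refine ⟨hfm.aestronglyMeasurable, ?_⟩
    have h := lintegral_infEDist_lt_top hD hℓ hsum hδ hs
    rw [← lintegral_tubeMeasure] at h
    refine lt_of_le_of_lt (le_of_eq (lintegral_congr_ae ?_)) h
    filter_upwards [hμpos] with t ht
    rw [hf, ← ofReal_norm, Complex.norm_cpow_eq_rpow_re_of_pos ht,
      ENNReal.ofReal_rpow_of_pos ht]
    simp
  have hz : distanceZeta δ (stringSet ℓ) s = ∫ t, f t ∂μ := by
    rw [hμ, ← map_infDist_thickening hℓ,
      integral_map (by fun_prop) hfm.aestronglyMeasurable, distanceZeta]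
  have hint' := integrable_add_measure.1 hint
  have hsumint := hasSum_integral_measure hint'.2
  have hval : ∀ r, 0 < r → ∫ t, f t ∂((2 : ENNReal) • (volume : Measure ℝ).restrict (Ioo 0 r)) =
      2 * ((r : ℂ) ^ s / s) := by
    intro r hr
    rw [integral_smul_measure, integral_Ioo_cpow hs0 hr]
    simp
  simp only [fun j => hval _ (min_half_pos hℓ.pos hδ j)] at hsumint
  have hz' : distanceZeta δ (stringSet ℓ) s =
      2 * ((δ : ℂ) ^ s / s) + ∫ t, f t ∂(innerTubeMeasure ℓ δ) := by
    rw [hz, hμ, integral_add_measure hint'.1 hint'.2, hval δ hδ]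
  have e1 : (fun j => ((min (ℓ j / 2) δ : ℝ) : ℂ) ^ s) =
      fun j => s / 2 * (2 * (((min (ℓ j / 2) δ : ℝ) : ℂ) ^ s / s)) := by
    funext j
    field_simp
  have e2 : s * distanceZeta δ (stringSet ℓ) s / 2 - (δ : ℂ) ^ s =
      s / 2 * ∫ t, f t ∂(innerTubeMeasure ℓ δ) := by
    rw [hz']
    field_simp
    ring
  rw [e1, e2]
  exact hsumint.mul_left (s / 2)

/-- Up to nonvanishing holomorphic factors the two zeta functions differ by an entire function, so a
continuation of the distance zeta function gives one of the geometric zeta function. -/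
theorem IsNonremovableSingularity.distanceZeta (hD : 0 < D) (hℓ : IsBoundedFractalString ℓ)
    (hsum : ∀ α, D < α → Summable fun j => ℓ j ^ α) {δ : ℝ} (hδ : 0 < δ) {s₀ : ℂ}
    (h : IsNonremovableSingularity (geometricZeta ℓ) D s₀) :
    IsNonremovableSingularity (distanceZeta δ (stringSet ℓ)) D s₀ := by
  rintro ⟨ρ, hρ, g, hg, hgeq⟩
  have hfin : {j | ¬ ℓ j / 2 ≤ δ}.Finite := Filter.eventually_cofinite.1 (eventually_half_le hℓ hδ)
  set F := hfin.toFinset with hF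
  have hcpow : ∀ r : ℝ, 0 < r → Differentiable ℂ fun s : ℂ => (r : ℂ) ^ s := fun r hr s =>
    (differentiableAt_id.const_cpow (Or.inl (by exact_mod_cast hr.ne')))
  refine h ⟨ρ, hρ, fun s => ((2 : ℝ) : ℂ) ^ s * (s * g s / 2 - (δ : ℂ) ^ s -
    ∑ j ∈ F, (((min (ℓ j / 2) δ : ℝ) : ℂ) ^ s - ((ℓ j / 2 : ℝ) : ℂ) ^ s)), ?_, ?_⟩
  · refine (hcpow 2 zero_lt_two).differentiableOn.mul ((DifferentiableOn.sub ?_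
      (hcpow δ hδ).differentiableOn).sub (DifferentiableOn.fun_sum fun j _ => ?_))
    · exact (differentiableOn_id.mul hg).div_const 2
    · exact ((hcpow _ (min_half_pos hℓ.pos hδ j)).sub
        (hcpow _ (by linarith [hℓ.pos j]))).differentiableOn
  · intro s hs
    have hsD : D < s.re := hs.2
    have h1 := hasSum_distanceZeta hD hℓ hsum hδ hsD
    have h2 : HasSum (fun j => ((min (ℓ j / 2) δ : ℝ) : ℂ) ^ s - ((ℓ j / 2 : ℝ) : ℂ) ^ s)
        (∑ j ∈ F, (((min (ℓ j / 2) δ : ℝ) : ℂ) ^ s - ((ℓ j / 2 : ℝ) : ℂ) ^ s)) := by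
      refine hasSum_sum_of_ne_finset_zero fun j hj => ?_
      have hj' : ℓ j / 2 ≤ δ := by simpa [hF] using hj
      rw [min_eq_left hj', sub_self]
    have h3 := (h1.sub h2).mul_left (((2 : ℝ) : ℂ) ^ s)
    simp only
    rw [← hgeq hs, ← h3.tsum_eq, geometricZeta]
    refine tsum_congr fun j => ?_
    rw [sub_sub_cancel, ← Complex.mul_cpow_ofReal_nonneg zero_le_two (by linarith [hℓ.pos j]),
      ← Complex.ofReal_mul]
    congr 2
    ring

end Dimensions

/-! ### Singularities of the geometric zeta function -/

section Singularities

variable {D : ℝ}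

theorem mul_ratio_cpow (D : ℝ) (k : ℕ) (s : ℂ) :
    ((k : ℂ) + 2) * (ratio D k : ℂ) ^ s =
      Complex.exp ((1 - s / D) * (Real.log ((k : ℝ) + 2) : ℝ)) := by
  have hk : (0 : ℝ) < (k : ℝ) + 2 := by positivity
  have hlog : Real.log (ratio D k) = -(1 / D) * Real.log ((k : ℝ) + 2) := by
    rw [ratio, Real.log_rpow (by positivity)]
    push_cast
    rfl
  rw [Complex.cpow_def_of_ne_zero (by exact_mod_cast (ratio_pos D k).ne'),
    ← Complex.ofReal_log (ratio_pos D k).le, hlog]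
  have h1 : ((k : ℂ) + 2) = Complex.exp (Real.log ((k : ℝ) + 2) : ℝ) := by
    rw [← Complex.ofReal_exp, Real.exp_log hk]
    push_cast
    rfl
  nth_rewrite 1 [h1]
  rw [← Complex.exp_add]
  congr 1
  push_cast
  ring

/-- If `m < 2 p` is not the prime `p` then `m` and `p` have no common power, so the poles of the
zeta function of the Cantor set with `p` intervals, apart from `D`, are not poles of the one
with `m` intervals. -/
theorem mul_ratio_cpow_ne_one (hD : 0 < D) {p : ℕ} (hp : p.Prime) {n : ℤ} (hn : n ≠ 0) {k : ℕ}
    (hk : k + 2 < 2 * p) (hkp : k + 2 ≠ p) :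
    ((k : ℂ) + 2) * (ratio D k : ℂ) ^ ((D : ℂ) +
      ((n * (2 * Real.pi * D / Real.log p) : ℝ) : ℂ) * Complex.I) ≠ 1 := by
  have hDne : (D : ℂ) ≠ 0 := by exact_mod_cast hD.ne'
  have hL : 0 < Real.log p := Real.log_pos (by exact_mod_cast hp.one_lt)
  have hLne : ((Real.log p : ℝ) : ℂ) ≠ 0 := by exact_mod_cast hL.ne'
  have hπ : ((Real.pi : ℝ) : ℂ) ≠ 0 := by exact_mod_cast Real.pi_ne_zero
  rw [mul_ratio_cpow D, Ne, Complex.exp_eq_one_iff]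
  rintro ⟨n', hn'⟩
  have h1 : (n : ℂ) * (Real.log ((k : ℝ) + 2) : ℝ) = -n' * (Real.log p : ℝ) := by
    have h2 : (2 * Real.pi * Complex.I) * ((n : ℂ) * (Real.log ((k : ℝ) + 2) : ℝ)) =
        (2 * Real.pi * Complex.I) * (-n' * (Real.log p : ℝ)) := by
      push_cast at hn' hLne ⊢
      field_simp at hn'
      linear_combination (-1 : ℂ) * hn'
    exact mul_left_cancel₀ (by simp [hπ]) h2
  have h3 : (n : ℝ) * Real.log ((k : ℝ) + 2) = -n' * Real.log p := by exact_mod_cast h1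
  have hm : 0 < Real.log ((k : ℝ) + 2) :=
    Real.log_pos (by have : (0 : ℝ) ≤ k := by positivity
                     linarith)
  have h4 : (n.natAbs : ℝ) * Real.log ((k : ℝ) + 2) = (n'.natAbs : ℝ) * Real.log p := by
    have := congrArg abs h3
    rw [abs_mul, abs_mul, abs_of_pos hm, abs_of_pos hL, abs_neg] at this
    rwa [Nat.cast_natAbs, Nat.cast_natAbs, Int.cast_abs, Int.cast_abs]
  have h5 : (k + 2) ^ n.natAbs = p ^ n'.natAbs := by
    rw [← Real.log_pow, ← Real.log_pow] at h4
    have hp0 : (0 : ℝ) < p := by exact_mod_cast hp.pos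
    have := Real.log_injOn_pos (mem_Ioi.2 (by positivity)) (mem_Ioi.2 (by positivity)) h4
    exact_mod_cast this
  have hn0 : n.natAbs ≠ 0 := Int.natAbs_ne_zero.2 hn
  have hn'0 : n'.natAbs ≠ 0 := by
    intro h
    rw [h, pow_zero] at h5
    have := Nat.one_lt_pow hn0 (by omega : 1 < k + 2)
    omega
  have hdvd : p ∣ k + 2 :=
    hp.dvd_of_dvd_pow (h5 ▸ dvd_pow_self p hn'0)
  obtain ⟨c, hc⟩ := hdvd
  have hc1 : c ≠ 1 := fun h => hkp (by rw [hc, h, mul_one])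
  have hc0 : c ≠ 0 := fun h => by rw [h, mul_zero] at hc; omega
  have : p * 2 ≤ p * c := Nat.mul_le_mul_left p (by omega)
  omega

theorem continuousAt_cantorZeta (hD : 0 < D ∧ D < 1) {k : ℕ} {s : ℂ}
    (hs : ((k : ℂ) + 2) * (ratio D k : ℂ) ^ s ≠ 1) : ContinuousAt (cantorZeta D k) s := by
  have h1 : ContinuousAt (fun s : ℂ => (firstGap D k : ℂ) ^ s) s :=
    continuousAt_const_cpow (by exact_mod_cast (firstGap_pos hD k).ne')
  have h2 : ContinuousAt (fun s : ℂ => (ratio D k : ℂ) ^ s) s :=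
    continuousAt_const_cpow (by exact_mod_cast (ratio_pos D k).ne')
  exact (h1.mul continuousAt_const).div (continuousAt_const.sub (continuousAt_const.mul h2))
    (sub_ne_zero.2 hs.symm)

/-- The residue estimate. Near the pole `s₁` of the term with `m = p`, the factor
`1 - p ^ (-ε/D)` compensates this pole. It makes the finitely many nonresonant terms with `m < 2 p`
vanish in the limit, and it bounds all terms with `m ≥ 2 p`, resonant or not, since
`|1 - z| ≥ 1 - |z|`. So if the sum had a continuous continuation to `s₁`, then the term of `p` would
be bounded by the tail from `2 p` on. -/
theorem cantorZeta_pole_le_tail (hD : 0 < D ∧ D < 1) {p : ℕ} (hp : p.Prime) {n : ℤ} (hn : n ≠ 0)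
    {s₁ : ℂ} (hs₁ : s₁ = (D : ℂ) + ((n * (2 * Real.pi * D / Real.log p) : ℝ) : ℂ) * Complex.I)
    {g : ℂ → ℂ} (hg : ContinuousAt g s₁)
    (hgeq : ∀ᶠ ε : ℝ in 𝓝[>] 0, HasSum (fun k => cantorZeta D k (s₁ + ε)) (g (s₁ + ε))) :
    firstGap D (p - 2) ^ D * ((p - 1 : ℕ) : ℝ) ≤
      ∑' j : ℕ, ((1 / 2 : ℝ) ^ D) ^ (j + (2 * p - 1)) * ((j + (2 * p - 1) : ℕ) : ℝ) := by
  have hp2 := hp.two_le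
  set x : ℝ := (1 / 2 : ℝ) ^ D with hx
  have hx0 : 0 < x := by positivity
  have hx1 : x < 1 := Real.rpow_lt_one (by norm_num) (by norm_num) hD.1
  have hL : 0 < Real.log p := Real.log_pos (by exact_mod_cast hp.one_lt)
  have hDne : (D : ℂ) ≠ 0 := by exact_mod_cast hD.1.ne'
  have hLne : ((Real.log p : ℝ) : ℂ) ≠ 0 := by exact_mod_cast hL.ne'
  have hpk : (((p - 2 : ℕ) : ℝ) + 2) = p := by
    rw [Nat.cast_sub hp2]; push_cast; ring
  set q : ℝ → ℝ := fun ε => 1 - Real.exp (-(ε / D) * Real.log p) with hq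
  have hqpos : ∀ ε, 0 < ε → 0 < q ε := by
    intro ε hε
    have h1 : 0 < ε / D * Real.log p := mul_pos (div_pos hε hD.1) hL
    have : Real.exp (-(ε / D) * Real.log p) < 1 := Real.exp_lt_one_iff.2 (by linarith)
    simp only [hq]; linarith
  have hqlim : Tendsto (fun ε => (q ε : ℂ)) (𝓝[>] 0) (𝓝 0) := by
    have hc : Continuous fun ε => (q ε : ℂ) := by simp only [hq]; fun_prop
    have := hc.tendsto 0
    simp only [hq, zero_div, neg_zero, zero_mul, Real.exp_zero, sub_self,
      Complex.ofReal_zero] at this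
    exact this.mono_left nhdsWithin_le_nhds
  have hslim : Tendsto (fun ε : ℝ => s₁ + (ε : ℂ)) (𝓝[>] 0) (𝓝 s₁) := by
    have hc : Continuous fun ε : ℝ => s₁ + (ε : ℂ) := by fun_prop
    have := hc.tendsto 0
    simp only [Complex.ofReal_zero, add_zero] at this
    exact this.mono_left nhdsWithin_le_nhds
  have hre : ∀ ε : ℝ, (s₁ + (ε : ℂ)).re = D + ε := by
    intro ε
    rw [hs₁, Complex.add_re, Complex.add_re, Complex.re_ofReal_mul]
    simp
  -- At `s₁ + ε` the term of `p` has the denominator `1 - p ^ (-ε/D)`, as `s₁` is its pole.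
  have hpole : ∀ ε : ℝ, 0 < ε → ‖(q ε : ℂ) * cantorZeta D (p - 2) (s₁ + ε)‖ =
      firstGap D (p - 2) ^ (D + ε) * ((p - 1 : ℕ) : ℝ) := by
    intro ε hε
    have hw : (((p - 2 : ℕ) : ℂ) + 2) * (ratio D (p - 2) : ℂ) ^ (s₁ + ε) =
        (Real.exp (-(ε / D) * Real.log p) : ℝ) := by
      rw [mul_ratio_cpow D, hpk, Complex.ofReal_exp]
      have e : (1 - (s₁ + (ε : ℂ)) / D) * (Real.log p : ℝ) =
          ((-(ε / D) * Real.log p : ℝ) : ℂ) + ((-n : ℤ) : ℂ) * (2 * Real.pi * Complex.I) := by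
        rw [hs₁]
        push_cast at hLne ⊢
        field_simp
        ring
      rw [e, Complex.exp_add, Complex.exp_int_mul_two_pi_mul_I, mul_one]
    have hq' : (1 - ((Real.exp (-(ε / D) * Real.log p) : ℝ) : ℂ)) = (q ε : ℂ) := by
      simp only [hq]; push_cast; rfl
    have hqne : (q ε : ℂ) ≠ 0 := by exact_mod_cast (hqpos ε hε).ne'
    rw [cantorZeta, hw, hq', mul_div_cancel₀ _ hqne, norm_mul,
      Complex.norm_cpow_eq_rpow_re_of_pos (firstGap_pos hD _), hre]
    congr 1
    have e2 : (((p - 2 : ℕ) : ℂ) + 1) = ((p - 1 : ℕ) : ℂ) := by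
      rw [show p - 1 = (p - 2) + 1 by omega]; push_cast; rfl
    rw [e2, Complex.norm_natCast]
  -- For `m ≥ p` the denominator is at least `1 - m ^ (-ε/D) ≥ 1 - p ^ (-ε/D)` in absolute value.
  have htail : ∀ ε : ℝ, 0 < ε → ∀ j : ℕ,
      ‖(q ε : ℂ) * cantorZeta D (j + (2 * p - 2)) (s₁ + ε)‖ ≤
        x ^ (j + (2 * p - 1)) * ((j + (2 * p - 1) : ℕ) : ℝ) := by
    intro ε hε j
    set k := j + (2 * p - 2) with hk
    have hk1 : j + (2 * p - 1) = k + 1 := by omega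
    rw [hk1]
    have hden : q ε ≤ ‖1 - ((k : ℂ) + 2) * (ratio D k : ℂ) ^ (s₁ + (ε : ℂ))‖ := by
      refine le_trans ?_ (norm_sub_norm_le _ _)
      rw [norm_one, mul_ratio_cpow D, Complex.norm_exp, Complex.re_mul_ofReal, Complex.sub_re,
        Complex.one_re, Complex.div_ofReal_re, hre]
      refine sub_le_sub_left (Real.exp_le_exp.2 ?_) 1
      have e : 1 - (D + ε) / D = -(ε / D) := by
        have := hD.1.ne'
        field_simp
        ring
      rw [e]
      refine mul_le_mul_of_nonpos_left (Real.log_le_log (by exact_mod_cast hp.pos) ?_)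
        (neg_nonpos.2 (div_pos hε hD.1).le)
      have : p ≤ k + 2 := by omega
      exact_mod_cast this
    have hden0 := (hqpos ε hε).trans_le hden
    rw [cantorZeta, norm_mul, norm_div, norm_mul,
      Complex.norm_cpow_eq_rpow_re_of_pos (firstGap_pos hD _), hre, Complex.norm_real,
      Real.norm_of_nonneg (hqpos ε hε).le, mul_div_assoc', div_le_iff₀ hden0, mul_comm]
    have e1 : firstGap D k ^ (D + ε) ≤ x ^ (k + 1) := by
      have hle := firstGap_le hD k
      have hle1 : firstGap D k ≤ 1 := hle.trans (pow_le_one₀ (by norm_num) (by norm_num))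
      refine (Real.rpow_le_rpow_of_exponent_ge (firstGap_pos hD k) hle1
        (by linarith : D ≤ D + ε)).trans ?_
      refine (Real.rpow_le_rpow (firstGap_pos hD k).le hle hD.1.le).trans_eq ?_
      rw [hx, ← Real.rpow_natCast, ← Real.rpow_natCast, ← Real.rpow_mul (by norm_num),
        ← Real.rpow_mul (by norm_num), mul_comm]
    have e2 : ‖((k : ℂ) + 1)‖ = ((k + 1 : ℕ) : ℝ) := by
      rw [← Complex.norm_natCast]; push_cast; rfl
    rw [e2]
    gcongr
    exact (hqpos ε hε).le
  have hsumT : Summable fun j : ℕ => x ^ (j + (2 * p - 1)) * ((j + (2 * p - 1) : ℕ) : ℝ) := by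
    have h := summable_pow_mul_geometric_of_norm_lt_one 1 (r := x)
      (by rwa [Real.norm_of_nonneg hx0.le])
    simp only [pow_one] at h
    exact ((summable_nat_add_iff (2 * p - 1)).2 h).congr fun j => mul_comm _ _
  set T := ∑' j : ℕ, x ^ (j + (2 * p - 1)) * ((j + (2 * p - 1) : ℕ) : ℝ) with hT
  set S := (Finset.range (2 * p - 2)).erase (p - 2) with hS
  have hmain : ∀ᶠ ε : ℝ in 𝓝[>] 0, firstGap D (p - 2) ^ (D + ε) * ((p - 1 : ℕ) : ℝ) ≤
      ‖(q ε : ℂ) * g (s₁ + ε)‖ + ∑ k ∈ S, ‖(q ε : ℂ) * cantorZeta D k (s₁ + ε)‖ + T := by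
    filter_upwards [hgeq, self_mem_nhdsWithin] with ε h hε
    have hε0 : 0 < ε := hε
    have h' := h.mul_left (q ε : ℂ)
    have hsplit := h'.summable.sum_add_tsum_nat_add (2 * p - 2)
    rw [h'.tsum_eq, ← Finset.add_sum_erase _ _ (Finset.mem_range.2
      (by omega : p - 2 < 2 * p - 2)), ← hS] at hsplit
    rw [← hpole ε hε0]
    have htl : ‖∑' j : ℕ, (q ε : ℂ) * cantorZeta D (j + (2 * p - 2)) (s₁ + ε)‖ ≤ T :=
      tsum_of_norm_bounded hsumT.hasSum (htail ε hε0)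
    have e : (q ε : ℂ) * cantorZeta D (p - 2) (s₁ + ε) = (q ε : ℂ) * g (s₁ + ε) -
        ∑ k ∈ S, (q ε : ℂ) * cantorZeta D k (s₁ + ε) -
        ∑' j : ℕ, (q ε : ℂ) * cantorZeta D (j + (2 * p - 2)) (s₁ + ε) := by
      rw [← hsplit]; ring
    rw [e]
    refine (norm_sub_le _ _).trans (add_le_add ((norm_sub_le _ _).trans ?_) htl)
    gcongr
    exact norm_sum_le _ _
  have hlim1 : Tendsto (fun ε : ℝ => firstGap D (p - 2) ^ (D + ε) * ((p - 1 : ℕ) : ℝ)) (𝓝[>] 0)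
      (𝓝 (firstGap D (p - 2) ^ D * ((p - 1 : ℕ) : ℝ))) := by
    have hc : Continuous fun ε : ℝ => firstGap D (p - 2) ^ (D + ε) * ((p - 1 : ℕ) : ℝ) :=
      ((Real.continuous_const_rpow (firstGap_pos hD _).ne').comp
        (continuous_const.add continuous_id)).mul continuous_const
    have := hc.tendsto 0
    simp only [add_zero] at this
    exact this.mono_left nhdsWithin_le_nhds
  have hlim2 : Tendsto (fun ε : ℝ => ‖(q ε : ℂ) * g (s₁ + ε)‖ +
      ∑ k ∈ S, ‖(q ε : ℂ) * cantorZeta D k (s₁ + ε)‖ + T) (𝓝[>] 0) (𝓝 T) := by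
    have h0 : Tendsto (fun ε : ℝ => ‖(q ε : ℂ) * g (s₁ + ε)‖) (𝓝[>] 0) (𝓝 0) := by
      have := (hqlim.mul (hg.tendsto.comp hslim)).norm
      simpa using this
    have h1 : Tendsto (fun ε : ℝ => ∑ k ∈ S, ‖(q ε : ℂ) * cantorZeta D k (s₁ + ε)‖)
        (𝓝[>] 0) (𝓝 (∑ _k ∈ S, (0 : ℝ))) := by
      refine tendsto_finsetSum _ fun k hk => ?_
      rw [hS, Finset.mem_erase, Finset.mem_range] at hk
      have hne := mul_ratio_cpow_ne_one hD.1 hp hn (k := k) (by omega) (by omega)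
      rw [← hs₁] at hne
      have := (hqlim.mul ((continuousAt_cantorZeta hD hne).tendsto.comp hslim)).norm
      simpa using this
    have := (h0.add h1).add_const T
    simpa using this
  exact le_of_tendsto_of_tendsto hlim1 hlim2 hmain

/-- For large `p` the term of `p` dominates the tail from `2 p` on. -/
theorem eventually_tail_lt (hD : 0 < D ∧ D < 1) : ∀ᶠ p : ℕ in atTop,
    ∑' j : ℕ, ((1 / 2 : ℝ) ^ D) ^ (j + (2 * p - 1)) * ((j + (2 * p - 1) : ℕ) : ℝ) <
      firstGap D (p - 2) ^ D * ((p - 1 : ℕ) : ℝ) := by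
  set x : ℝ := (1 / 2 : ℝ) ^ D with hx
  have hx0 : 0 < x := by positivity
  have hx1 : x < 1 := Real.rpow_lt_one (by norm_num) (by norm_num) hD.1
  set C := ∑' j : ℕ, x ^ j * ((j + 1 : ℕ) : ℝ) with hC
  have hsumC : Summable fun j : ℕ => x ^ j * ((j + 1 : ℕ) : ℝ) := by
    have h := summable_pow_mul_geometric_of_norm_lt_one 1 (r := x)
      (by rwa [Real.norm_of_nonneg hx0.le])
    have h' := summable_geometric_of_lt_one hx0.le hx1
    simp only [pow_one] at h
    refine (h.add h').congr fun j => ?_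
    push_cast
    ring
  have hC0 : 0 ≤ C := tsum_nonneg fun j => by positivity
  have hneg : 1 - 1 / D < 0 := by
    have := (one_lt_div hD.1).2 hD.2
    linarith
  set κ : ℝ := 1 - (2 : ℝ) ^ (1 - 1 / D) with hκ
  have hκ0 : 0 < κ := by
    have := Real.rpow_lt_one_of_one_lt_of_neg (x := 2) (by norm_num) hneg
    linarith
  have hlim : Tendsto (fun p : ℕ => 2 * C * ((p : ℝ) * x ^ p)) atTop (𝓝 0) := by
    have := (tendsto_self_mul_const_pow_of_lt_one hx0.le hx1).const_mul (2 * C)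
    simpa using this
  filter_upwards [hlim.eventually (gt_mem_nhds hκ0), eventually_ge_atTop 2] with p hp hp2
  have h1 : ∑' j : ℕ, x ^ (j + (2 * p - 1)) * ((j + (2 * p - 1) : ℕ) : ℝ) ≤
      x ^ (2 * p - 1) * ((2 * p - 1 : ℕ) : ℝ) * C := by
    rw [hC, ← tsum_mul_left]
    have hle : ∀ j : ℕ, x ^ (j + (2 * p - 1)) * ((j + (2 * p - 1) : ℕ) : ℝ) ≤
        x ^ (2 * p - 1) * ((2 * p - 1 : ℕ) : ℝ) * (x ^ j * ((j + 1 : ℕ) : ℝ)) := by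
      intro j
      have h2 : j + (2 * p - 1) ≤ (2 * p - 1) * (j + 1) := by
        have : 1 * j ≤ (2 * p - 1) * j := Nat.mul_le_mul_right j (by omega)
        rw [mul_add]
        omega
      have h3 : ((j + (2 * p - 1) : ℕ) : ℝ) ≤ ((2 * p - 1 : ℕ) : ℝ) * ((j + 1 : ℕ) : ℝ) := by
        exact_mod_cast h2
      calc x ^ (j + (2 * p - 1)) * ((j + (2 * p - 1) : ℕ) : ℝ)
          ≤ x ^ (j + (2 * p - 1)) * (((2 * p - 1 : ℕ) : ℝ) * ((j + 1 : ℕ) : ℝ)) := by gcongr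
        _ = _ := by rw [pow_add]; ring
    exact Summable.tsum_le_tsum hle
      (Summable.of_nonneg_of_le (fun j => by positivity) hle (hsumC.mul_left _))
      (hsumC.mul_left _)
  have h2 : x ^ (p - 1) * κ ≤ firstGap D (p - 2) ^ D * ((p - 1 : ℕ) : ℝ) := by
    set k := p - 2 with hk
    have hkp : p - 1 = k + 1 := by omega
    rw [hkp]
    set h := holeLength (k + 2) (ratio D k) with hh
    have hpos : 0 < h := holeLength_ratio_pos hD k
    have hmul : ((k : ℝ) + 1) * h = 1 - ((k : ℝ) + 2) ^ (1 - 1 / D) := by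
      have e := holeLength_mul (m := k + 2) (a := ratio D k) (by omega)
      have e' := ratio_rpow D k 1
      rw [Real.rpow_one] at e'
      rw [← e', ← hh] at *
      push_cast at e
      linarith
    have hκle : κ ≤ ((k : ℝ) + 1) * h := by
      rw [hmul, hκ]
      refine sub_le_sub_left (Real.rpow_le_rpow_of_nonpos (by norm_num) ?_ hneg.le) 1
      have : (0 : ℝ) ≤ k := by positivity
      linarith
    have hk0 : (0 : ℝ) ≤ k := by positivity
    have hle1 : h ≤ 1 := by
      have : 0 ≤ ((k : ℝ) + 2) ^ (1 - 1 / D) := by positivity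
      nlinarith [mul_nonneg hk0 hpos.le]
    have hhD : h ≤ h ^ D := by
      have := Real.rpow_le_rpow_of_exponent_ge hpos hle1 hD.2.le
      rwa [Real.rpow_one] at this
    have e1 : firstGap D k ^ D = x ^ (k + 1) * h ^ D := by
      rw [firstGap, ← hh, Real.mul_rpow (by positivity) hpos.le, hx, ← Real.rpow_natCast,
        ← Real.rpow_natCast, ← Real.rpow_mul (by norm_num), ← Real.rpow_mul (by norm_num), mul_comm D]
    rw [e1, mul_assoc]
    refine mul_le_mul_of_nonneg_left (hκle.trans ?_) (by positivity)
    push_cast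
    rw [mul_comm]
    gcongr
  refine h1.trans_lt (lt_of_lt_of_le ?_ h2)
  have e : x ^ (2 * p - 1) = x ^ (p - 1) * x ^ p := by
    rw [← pow_add]; congr 1; omega
  rw [e, mul_assoc, mul_assoc]
  refine mul_lt_mul_of_pos_left (lt_of_le_of_lt ?_ hp) (by positivity)
  have h3 : ((2 * p - 1 : ℕ) : ℝ) ≤ 2 * p := by
    have : 2 * p - 1 ≤ 2 * p := Nat.sub_le _ _
    exact_mod_cast this
  calc x ^ p * (((2 * p - 1 : ℕ) : ℝ) * C) ≤ x ^ p * ((2 * p) * C) := by gcongr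
    _ = _ := by ring

/-- Every point of the line `Re s = D` is a nonremovable singularity, because the poles
`D + 2 π i n D / log p` with nonvanishing residue are dense in this line. -/
theorem isNonremovableSingularity_of_hasSum (hD : 0 < D ∧ D < 1) {f : ℂ → ℂ}
    (hf : ∀ s : ℂ, D < s.re → HasSum (fun k => cantorZeta D k s) (f s)) {s₀ : ℂ}
    (hs₀ : s₀.re = D) : IsNonremovableSingularity f D s₀ := by
  rintro ⟨ρ, hρ, g, hg, hgeq⟩
  have hlog : Tendsto (fun p : ℕ => Real.log p) atTop atTop :=
    Real.tendsto_log_atTop.comp tendsto_natCast_atTop_atTop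
  obtain ⟨N, hN⟩ := eventually_atTop.1
    ((eventually_tail_lt hD).and (hlog.eventually_gt_atTop (2 * Real.pi * D / ρ)))
  obtain ⟨p, hpN, hp⟩ := Nat.exists_infinite_primes N
  obtain ⟨hlt, hlogp⟩ := hN p hpN
  have hL : 0 < Real.log p := Real.log_pos (by exact_mod_cast hp.one_lt)
  set d := 2 * Real.pi * D / Real.log p with hd
  have hd0 : 0 < d := by have := hD.1; have := Real.pi_pos; positivity
  have hdρ : d < ρ := by
    rw [hd, div_lt_iff₀ hL, mul_comm ρ]
    exact (div_lt_iff₀ hρ).1 hlogp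
  -- `n = 0` is excluded because at `D` the terms of all Cantor sets have poles.
  obtain ⟨n, hn, hn'⟩ : ∃ n : ℤ, n ≠ 0 ∧ |(n : ℝ) - s₀.im / d| ≤ 1 := by
    have h1 := Int.floor_le (s₀.im / d)
    have h2 := Int.lt_floor_add_one (s₀.im / d)
    by_cases h : ⌊s₀.im / d⌋ = 0
    · refine ⟨1, one_ne_zero, ?_⟩
      rw [h] at h1 h2
      push_cast at h1 h2 ⊢
      rw [abs_le]
      constructor <;> linarith
    · refine ⟨⌊s₀.im / d⌋, h, ?_⟩
      rw [abs_le]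
      constructor <;> linarith
  set s₁ : ℂ := (D : ℂ) + ((n * d : ℝ) : ℂ) * Complex.I with hs₁
  have hmem : s₁ ∈ Metric.ball s₀ ρ := by
    have e : s₁ - s₀ = ((n * d - s₀.im : ℝ) : ℂ) * Complex.I := by
      apply Complex.ext
      · rw [hs₁, Complex.sub_re, Complex.add_re, Complex.re_ofReal_mul, Complex.re_ofReal_mul, hs₀]
        simp
      · rw [hs₁, Complex.sub_im, Complex.add_im, Complex.im_ofReal_mul, Complex.im_ofReal_mul]
        simp
    rw [mem_ball_iff_norm, e, norm_mul, Complex.norm_I, mul_one, Complex.norm_real,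
      Real.norm_eq_abs]
    have e2 : n * d - s₀.im = ((n : ℝ) - s₀.im / d) * d := by field_simp
    rw [e2, abs_mul, abs_of_pos hd0]
    exact (mul_le_of_le_one_left hd0.le hn').trans_lt hdρ
  have hgc : ContinuousAt g s₁ :=
    (hg.differentiableAt (Metric.isOpen_ball.mem_nhds hmem)).continuousAt
  have hev : ∀ᶠ ε : ℝ in 𝓝[>] 0, HasSum (fun k => cantorZeta D k (s₁ + ε)) (g (s₁ + ε)) := by
    have hc : Continuous fun ε : ℝ => s₁ + (ε : ℂ) := by fun_prop
    have h1 : ∀ᶠ ε : ℝ in 𝓝 0, s₁ + (ε : ℂ) ∈ Metric.ball s₀ ρ :=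
      hc.continuousAt.eventually (Metric.isOpen_ball.mem_nhds (by simpa using hmem))
    filter_upwards [h1.filter_mono nhdsWithin_le_nhds, self_mem_nhdsWithin] with ε hε hε0
    have hre : D < (s₁ + (ε : ℂ)).re := by
      rw [hs₁, Complex.add_re, Complex.add_re, Complex.re_ofReal_mul]
      simpa using hε0
    rw [← hgeq ⟨hε, hre⟩]
    exact hf _ hre
  exact absurd (cantorZeta_pole_le_tail hD hp hn hs₁ hgc hev) (not_le.2 hlt)

end Singularities

end FractalZeta

theorem mainTheorem8 (D : ℝ) (hD : 0 < D ∧ D < 1) :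
    ∃ ℓ : ℕ → ℝ,
      FractalZeta.IsBoundedFractalString ℓ ∧
      (∃ L : ℕ → ℕ → ℝ,
        (∀ k : ℕ, FractalZeta.IsFractalStringOf (L k)
          (FractalZeta.scaledCantorSet ((1 / 2 : ℝ) ^ (k + 1)) (k + 2)
            (((k + 2 : ℕ) : ℝ) ^ (-(1 / D))))) ∧
        FractalZeta.IsDisjointUnion ℓ L) ∧
      FractalZeta.stringUpperMinkowskiDim ℓ = D ∧
      FractalZeta.geometricAbscissa ℓ = D ∧
      FractalZeta.IsMaximallyHyperfractalString ℓ ∧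
      Bornology.IsBounded (FractalZeta.stringSet ℓ) ∧
      FractalZeta.upperMinkowskiDim (FractalZeta.stringSet ℓ) = D ∧
      (∀ δ > 0, FractalZeta.distanceAbscissa δ (FractalZeta.stringSet ℓ) = D) ∧
      FractalZeta.IsMaximallyHyperfractalSet (FractalZeta.stringSet ℓ) := by
  open FractalZeta in
  obtain ⟨ℓ, E, hE, hℓ⟩ := exists_gapString hD
  have hb := firstGap_pos hD 0
  have hlev : HasCantorLevels ℓ D (firstGap D 0) := by
    intro n
    obtain ⟨S, hS, hS'⟩ := exists_finset_gapLength_eq D n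
    refine ⟨S.map E.symm.toEmbedding, by rw [Finset.card_map, hS], fun j hj => ?_⟩
    obtain ⟨q, hq, rfl⟩ := Finset.mem_map.1 hj
    rw [hE]
    simpa using hS' q hq
  have hsum : ∀ α, D < α → Summable fun j => ℓ j ^ α := by
    intro α hα
    simp only [hE]
    exact E.summable_iff.2 (summable_gapLength_rpow hD hα)
  have hsing : ∀ s₀ : ℂ, s₀.re = D → IsNonremovableSingularity (geometricZeta ℓ) D s₀ := by
    intro s₀ hs₀
    refine isNonremovableSingularity_of_hasSum hD (fun s hs => ?_) hs₀
    have h := hasSum_cantorZeta_tsum hD hs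
    rw [← E.tsum_eq] at h
    simp only [geometricZeta, hE]
    exact h
  have habs := geometricAbscissa_eq hD hℓ.pos hb hlev hsum
  have hdist : ∀ δ > 0, distanceAbscissa δ (stringSet ℓ) = D :=
    fun δ hδ => distanceAbscissa_eq hD hℓ hb hlev hsum hδ
  refine ⟨ℓ, hℓ, exists_isDisjointUnion hD E hE, ?_, habs, ?_, isBounded_stringSet hℓ, ?_, hdist,
    ?_⟩
  · exact upperExponent_eq hD hℓ.pos hb hlev hsum (fun t => (volume_inner_tube hℓ t).ge)
      fun t => (volume_inner_tube hℓ t).trans_le le_add_self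
  · intro s₀ hs₀
    rw [habs] at hs₀ ⊢
    exact hsing s₀ hs₀
  · exact upperExponent_eq hD hℓ.pos hb hlev hsum
      (fun t => (volume_outer_tube hℓ t).symm ▸ le_add_self) fun t => (volume_outer_tube hℓ t).le
  · intro δ hδ s₀ hs₀
    rw [hdist δ hδ] at hs₀ ⊢
    exact (hsing s₀ hs₀).distanceZeta hD.1 hℓ hsum hδ
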